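/- Let $r\ge 2$ and $n_{\mathrm{cp}}\ge 0$ be integers with $n_{\mathrm{cp}}<r-1$, and let $k\ge 1$ be an integer with $k\ge k^{\mathrm{MAIM}}$, where $$k^{\mathrm{MAIM}}=\Big\lceil \tfrac{r}{r-1-n_{\mathrm{cp}}}-2\Big\rceil+\frac{1+(-1)^{\lceil \frac{r}{r-1-n_{\mathrm{cp}}}-2\rceil}}{2}.$$ *The scheme.* Consider a uniform grid of mesh width $h=\Delta x$ with cells $I_j$ of centre $x_j$, interfaces $x_{j\pm1/2}=x_j\pm h/2$, and cell averages $\bar u_j=\frac1h\int_{I_j}u$. For $s=0,\dots,r-1$ let $p_s$ be the polynomial of degree at most $r-1$ whose averages over the cells $I_{j+s-r+1},\dots,I_{j+s}$ are the $\bar u$'s, put $u^{s}=p_s(x_{j+1/2})$, and let $d_s=\binom rs\binom{r-1}s\big/\binom{2r-1}{r}$ be the optimal weights, for which $\sum_s d_su^s$ is the value at $x_{j+1/2}$ of the reconstruction polynomial on the $2r-1$ cells $I_{j-r+1},\dots,I_{j+r-1}$. The Jiang–Shu indicators and weights are, with $\epsilon\ge0$, $$\beta_s=\sum_{l=1}^{r-1}\int_{I_j}h^{2l-1}\big(p_s^{(l)}(x)\big)^2dx,\qquad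 \omega^{\mathrm{JS}}_s=\frac{\alpha_s^{\mathrm{JS}}}{\sum_l\alpha_l^{\mathrm{JS}}},\qquad \alpha_s^{\mathrm{JS}}=\frac{d_s}{(\epsilon+\beta_s)^2}.$$ For constants $A>0$, $\delta>0$ let $\mathrm{sg}(x)=x/|x|$ if $|x|\ge\delta$ and $\mathrm{sg}(x)=x/\big((\delta^2-x^2)^{k+3}+|x|\big)$ if $|x|<\delta$, and $$f_s(\omega)=A\Big(\tfrac{1+(-1)^k}2+\tfrac{1+(-1)^{k+1}}2\,\mathrm{sg}(\omega-d_s)\Big),\qquad g_s(\omega)=d_s+\frac{f_s(\omega)(\omega-d_s)^{k+1}}{f_s(\omega)(\omega-d_s)^k+\omega^{a_s}(1-\omega)^{b_s}},$$ where, with a constant $\epsilon_A\ge0$, the exponents $a_s,b_s$ are of one of five types: (1) $a_s=\frac{d_s}{m_s\omega+\epsilon_A}$, $b_s=\frac{1-d_s}{m_s(1-\omega)+\epsilon_A}$ with $m_s>0$; (2) $a_s=b_s=1$ if $\mathrm{CFS}_s<\omega<1-\frac{1-d_s}{d_s}\mathrm{CFS}_s$ and $a_s=b_s=Qk$ otherwise,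 with $Q\ge1/k$ and $0<\mathrm{CFS}_s\le d_s$; (3) $a_s=b_s=\max_j\beta_j/(\min_j\beta_j+\epsilon_A)$; (4) $a_s=b_s=\max_j(\omega_j^{\mathrm{JS}}/d_j)\big/\big(\min_j(\omega_j^{\mathrm{JS}}/d_j)+\epsilon_A\big)$; (5) $a_s=b_s=C$ with a constant $C\ge1$. The WENO-MAIM$i$ weights (for type $i$) are $\omega_s=\alpha_s/\sum_l\alpha_l$ with $\alpha_s=g_s(\omega_s^{\mathrm{JS}})$, and $u^-_{j+1/2}=\sum_s\omega_su^s$; the value $u^+_{j+1/2}$ is obtained by the mirror-symmetric procedure, centred at $I_{j+1}$. For the conservation law $u_t+f(u)_x=0$ with $f\in C^2(\mathbb R)$, and a constant $\alpha$, the numerical flux is the Lax–Friedrichs flux $\hat f_{j+1/2}=\frac12\big[f(u^-_{j+1/2})+f(u^+_{j+1/2})-\alpha(u^+_{j+1/2}-u^-_{j+1/2})\big]$. *Claim.* Let $u$ be smooth ($C^\infty$) near a point $x_0$ that is a critical point of order $n_{\mathrm{cp}}$, i.e. $u'(x_0)=\dots=u^{(n_{\mathrm{cp}})}(x_0)=0$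 and $u^{(n_{\mathrm{cp}}+1)}(x_0)\ne0$. Then for every type $i=1,\dots,5$ the WENO-MAIM$i$ scheme has the optimal order $2r-1$ near $x_0$: there are $K,\rho,h_0>0$, independent of $\epsilon$, such that for all $\epsilon\ge0$, all $0<h<h_0$ and all cells with $|x_j-x_0|\le\rho$, $$|u^{\pm}_{j+1/2}-u(x_{j+1/2})|\le Kh^{2r-1},\qquad \Big|\frac{\hat f_{j+1/2}-\hat f_{j-1/2}}{h}-\frac{f(u(x_{j+1/2}))-f(u(x_{j-1/2}))}{h}\Big|\le Kh^{2r-1}.$$ -/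

import Mathlib

noncomputable section

namespace WENO

/-! ### Linear reconstruction

Cells are labelled relative to a reference cell, which is scaled to `[-1/2, 1/2]`: cell `m : ℤ` is
`[m - 1/2, m + 1/2]`, and `v m` is the average over it. -/

/-- The polynomial of degree at most `N - 1` whose averages over the `N` consecutive cells
`a, a + 1, …, a + N - 1` are `v a, …, v (a + N - 1)`: the derivative of the polynomial of degree at
most `N` that interpolates the primitive `∑ v` at the `N + 1` cell interfaces. -/
def reconPoly (N : ℕ) (a : ℤ) (v : ℤ → ℝ) : Polynomial ℝ :=
  Polynomial.derivative
    (Lagrange.interpolate (Finset.range (N + 1))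
      (fun i : ℕ => (a : ℝ) - 1 / 2 + (i : ℝ))
      (fun i : ℕ => ∑ q ∈ Finset.range i, v (a + (q : ℤ))))

/-- The reconstruction polynomial on the substencil `s`, which consists of the `r` cells
`s - r + 1, …, s`. -/
def subPoly (r : ℕ) (s : Fin r) (v : ℤ → ℝ) : Polynomial ℝ :=
  reconPoly r ((s : ℤ) - (r : ℤ) + 1) v

/-- The `r`-th order approximation at the right interface of the reference cell. -/
def subValue (r : ℕ) (s : Fin r) (v : ℤ → ℝ) : ℝ :=
  (subPoly r s v).eval (1 / 2)

/-- The optimal (linear) weights `d_s`: the unique numbers for which `∑ s, d_s * subValue r s v` is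
the interface value of the reconstruction polynomial on all `2 r - 1` cells `-(r - 1), …, r - 1`.
For `r = 3` they are `1/10, 6/10, 3/10`. -/
def optWeight (r : ℕ) (s : Fin r) : ℝ :=
  (r.choose s : ℝ) * ((r - 1).choose s : ℝ) / ((2 * r - 1).choose r : ℝ)

/-! ### The Jiang–Shu weights -/

/-- The Jiang–Shu smoothness indicator
`β_s = ∑_{l=1}^{r-1} ∫_{I_j} Δx^(2l-1) (p_s^{(l)}(x))^2 dx`, written in the scaled variable
`ξ = (x - x_j) / Δx`, in which the powers of `Δx` cancel. -/
def smoothInd (r : ℕ) (v : ℤ → ℝ) (s : Fin r) : ℝ :=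
  ∑ l ∈ Finset.Icc 1 (r - 1),
    ∫ ξ in (-(1 / 2) : ℝ)..(1 / 2),
      ((Polynomial.derivative^[l] (subPoly r s v)).eval ξ) ^ 2

def alphaJS (r : ℕ) (ε : ℝ) (v : ℤ → ℝ) (s : Fin r) : ℝ :=
  optWeight r s / (ε + smoothInd r v s) ^ 2

def weightJS (r : ℕ) (ε : ℝ) (v : ℤ → ℝ) (s : Fin r) : ℝ :=
  alphaJS r ε v s / ∑ l, alphaJS r ε v l

/-! ### The modified adaptive improved mapping functions -/

/-- The smoothing approximation of the signum function. -/
def sg (k : ℕ) (δ x : ℝ) : ℝ :=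
  if δ ≤ |x| then x / |x| else x / ((δ ^ 2 - x ^ 2) ^ (k + 3) + |x|)

/-- `f_s^MAIM`, as a function of `ω`. -/
def fMAIM (k : ℕ) (A δ d ω : ℝ) : ℝ :=
  A * ((1 + (-1) ^ k) / 2 + (1 + (-1) ^ (k + 1)) / 2 * sg k δ (ω - d))

/-- The five types of adaptive control functions, with their parameters. -/
inductive AdaType (r : ℕ) : Type
  | type1 (m : Fin r → ℝ)
  | type2 (Q : ℝ) (CFS : Fin r → ℝ)
  | type3
  | type4
  | type5 (C : ℝ)

/-- The conditions on the parameters of the adaptive control functions. -/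
def AdaType.Admissible {r : ℕ} (k : ℕ) : AdaType r → Prop
  | .type1 m => ∀ s, 0 < m s
  | .type2 Q CFS => (k : ℝ)⁻¹ ≤ Q ∧ ∀ s, 0 < CFS s ∧ CFS s ≤ optWeight r s
  | .type3 => True
  | .type4 => True
  | .type5 C => 1 ≤ C

/-- The value of type 2. -/
def ada2 {r : ℕ} (k : ℕ) (Q : ℝ) (CFS : Fin r → ℝ) (s : Fin r) (ω : ℝ) : ℝ :=
  if CFS s < ω ∧ ω < 1 - (1 - optWeight r s) / optWeight r s * CFS s then 1 else Q * k

/-- The exponent `f_{i,s}^{Ada0}` of `ω`, given the indicators `β` and the weights `w`;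
here `ω = w s`. -/
def AdaType.exp0 {r : ℕ} (T : AdaType r) (k : ℕ) (εA : ℝ) (β w : Fin r → ℝ) (s : Fin r) : ℝ :=
  match T with
  | .type1 m => optWeight r s / (m s * w s + εA)
  | .type2 Q CFS => ada2 k Q CFS s (w s)
  | .type3 => (⨆ j, β j) / ((⨅ j, β j) + εA)
  | .type4 => (⨆ j, w j / optWeight r j) / ((⨅ j, w j / optWeight r j) + εA)
  | .type5 C => C

/-- The exponent `f_{i,s}^{Ada1}` of `1 - ω`. -/
def AdaType.exp1 {r : ℕ} (T : AdaType r) (k : ℕ) (εA : ℝ) (β w : Fin r → ℝ) (s : Fin r) : ℝ :=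
  match T with
  | .type1 m => (1 - optWeight r s) / (m s * (1 - w s) + εA)
  | .type2 Q CFS => ada2 k Q CFS s (w s)
  | .type3 => (⨆ j, β j) / ((⨅ j, β j) + εA)
  | .type4 => (⨆ j, w j / optWeight r j) / ((⨅ j, w j / optWeight r j) + εA)
  | .type5 C => C

/-- The mapping function with the exponents `e0 = f^{Ada0}` and `e1 = f^{Ada1}`. -/
def gMAIM (k : ℕ) (A δ d e0 e1 ω : ℝ) : ℝ :=
  d + fMAIM k A δ d ω * (ω - d) ^ (k + 1) /
    (fMAIM k A δ d ω * (ω - d) ^ k + ω ^ e0 * (1 - ω) ^ e1)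

/-- The parameters of a WENO-MAIM scheme: `k`, `A`, `δ`, the small constants `ε` (in the WENO-JS
weights) and `εA` (in the adaptive control functions), and the type `i` of the control functions
with its own parameters. -/
structure Params (r : ℕ) where
  k : ℕ
  A : ℝ
  δ : ℝ
  ε : ℝ
  εA : ℝ
  T : AdaType r

/-- The mapping function applied to the WENO-JS weight. -/
def alphaMAIM {r : ℕ} (P : Params r) (v : ℤ → ℝ) (s : Fin r) : ℝ :=
  gMAIM P.k P.A P.δ (optWeight r s)
    (P.T.exp0 P.k P.εA (smoothInd r v) (weightJS r P.ε v) s)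
    (P.T.exp1 P.k P.εA (smoothInd r v) (weightJS r P.ε v) s)
    (weightJS r P.ε v s)

def weightMAIM {r : ℕ} (P : Params r) (v : ℤ → ℝ) (s : Fin r) : ℝ :=
  alphaMAIM P v s / ∑ l, alphaMAIM P v l

/-- The WENO-MAIM value at the right interface of the reference cell. -/
def recon {r : ℕ} (P : Params r) (v : ℤ → ℝ) : ℝ :=
  ∑ s, weightMAIM P v s * subValue r s v

/-! ### The finite volume scheme on a uniform grid of mesh width `h` -/

/-- The average of `u` over the cell of width `h` with centre `x`. -/
def cellAvg (u : ℝ → ℝ) (h x : ℝ) : ℝ :=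
  (1 / h) * ∫ ξ in (x - h / 2)..(x + h / 2), u ξ

/-- `u_{j+1/2}^-`, where `x = x_j`: the reconstruction at `x_j + h/2` biased to the left. -/
def uMinus {r : ℕ} (P : Params r) (u : ℝ → ℝ) (h x : ℝ) : ℝ :=
  recon P (fun m : ℤ => cellAvg u h (x + m * h))

/-- `u_{j+1/2}^+`, where `x = x_j`: the mirror image, at the same interface, of the left-biased
reconstruction; it is centred at the cell `j + 1`. -/
def uPlus {r : ℕ} (P : Params r) (u : ℝ → ℝ) (h x : ℝ) : ℝ :=
  recon P (fun m : ℤ => cellAvg u h (x + (1 - m) * h))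

/-- The Lax–Friedrichs flux for the flux function `f`. -/
def fluxLF (f : ℝ → ℝ) (α a b : ℝ) : ℝ :=
  1 / 2 * (f a + f b - α * (b - a))

/-- The numerical flux at the right interface `x_{j+1/2} = x + h/2` of the cell with centre `x`. -/
def numFlux {r : ℕ} (P : Params r) (f : ℝ → ℝ) (α : ℝ) (u : ℝ → ℝ) (h x : ℝ) : ℝ :=
  fluxLF f α (uMinus P u h x) (uPlus P u h x)

/-- The spatial operator `-(f̂_{j+1/2} - f̂_{j-1/2}) / h` at the cell with centre `x`. -/
def spatialOp {r : ℕ} (P : Params r) (f : ℝ → ℝ) (α : ℝ) (u : ℝ → ℝ) (h x : ℝ) : ℝ :=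
  -(1 / h) * (numFlux P f α u h x - numFlux P f α u h (x - h))

/-- The exact time derivative of the cell average over the cell with centre `x`, for a solution
of `u_t + f(u)_x = 0` with profile `u` at the given time. -/
def exactOp (f u : ℝ → ℝ) (h x : ℝ) : ℝ :=
  -(1 / h) * (f (u (x + h / 2)) - f (u (x - h / 2)))

/-- `x₀` is a critical point of `u` of order `n`; order `0` means that `u' x₀ ≠ 0`. -/
def IsCritOrder (u : ℝ → ℝ) (x₀ : ℝ) (n : ℕ) : Prop :=
  (∀ i, 1 ≤ i → i ≤ n → iteratedDeriv i u x₀ = 0) ∧ iteratedDeriv (n + 1) u x₀ ≠ 0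

/-- The threshold `k^MAIM`. -/
def kMAIM (r n : ℕ) : ℝ :=
  (⌈(r : ℝ) / ((r : ℝ) - 1 - n) - 2⌉ : ℝ) +
    (1 + (-1 : ℝ) ^ ⌈(r : ℝ) / ((r : ℝ) - 1 - n) - 2⌉) / 2

end WENO

end

open scoped ContDiff

/-!
Near `x₀` the derivative of order `n + 1` does not vanish, so all smoothness indicators agree with a
common quantity `B ≳ h ^ (2 * (n + 1))` up to a relative error `O(h ^ (r - 1 - n))`. Hence, whatever
`ε ≥ 0` is, the Jiang–Shu weights deviate from the optimal ones by `O(h ^ (r - 1 - n))`. The mapping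
function has contact of order `k + 1` (and `k + 2` for odd `k`) with the constant `d_s`, and
`kMAIM r n ≤ k` says precisely that the mapped weights then deviate by `O(h ^ r)` only. The
substencil values are accurate to order `r` and the deviations of the weights sum to zero, so the
mapped scheme differs from the optimal linear one by `O(h ^ (2 * r))`.

The error of the optimal linear scheme is `κ * u^(2r-1) * h ^ (2 * r - 1) + O(h ^ (2 * r))` with a
constant `κ`, and its leading term changes by `O(h ^ (2 * r))` from one interface to the next. The
difference of the fluxes thus regains the factor `h` that is lost in the division by `h`. The
right-biased value is the left-biased one for the mesh width `-h`, which is why the mesh width is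
allowed to have either sign.
-/

namespace WENO

open Filter Topology Asymptotics
open Set hiding range
open Finset (range sum_congr)
open Polynomial (C X derivative)
open scoped Nat Polynomial fwdDiff

section Analysis

lemma contDiffAt_iteratedDeriv {𝕜 F : Type*} [NontriviallyNormedField 𝕜] [NormedAddCommGroup F]
    [NormedSpace 𝕜 F] {u : 𝕜 → F} {x₀ : 𝕜} {m n : WithTop ℕ∞} {i : ℕ} (hu : ContDiffAt 𝕜 n u x₀)
    (hmn : m + i ≤ n) : ContDiffAt 𝕜 m (iteratedDeriv i u) x₀ := by
  rw [iteratedDeriv_eq_equiv_comp]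
  exact (LinearIsometryEquiv.contDiff _).contDiffAt.comp x₀ (hu.iteratedFDeriv_right hmn)

variable {u : ℝ → ℝ} {x₀ : ℝ}

lemma taylor_mean_remainder_of_contDiffAt {N : ℕ} {a b : ℝ}
    (hu : ∀ y ∈ uIcc a b, ContDiffAt ℝ (N + 1 : ℕ) u y) :
    ∃ y ∈ uIcc a b, u b - ∑ l ∈ range (N + 1), iteratedDeriv l u a * (b - a) ^ l / l ! =
      iteratedDeriv (N + 1) u y * (b - a) ^ (N + 1) / (N + 1)! := by
  rcases eq_or_ne a b with rfl | hab
  · exact ⟨a, left_mem_uIcc, by simp [Finset.sum_range_succ']⟩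
  obtain ⟨y, hy, h⟩ := taylor_mean_remainder_lagrange_iteratedDeriv hab
    (fun z hz => (hu z hz).contDiffWithinAt)
  refine ⟨y, Ioo_subset_Icc_self hy, h ▸ ?_⟩
  rw [taylor_within_apply]
  congr 1
  refine sum_congr rfl fun l hl => ?_
  rw [iteratedDerivWithin_eq_iteratedDeriv (uniqueDiffOn_uIcc hab)
    ((hu a left_mem_uIcc).of_le (by exact_mod_cast (Finset.mem_range.1 hl).le)) left_mem_uIcc,
    smul_eq_mul]
  ring

theorem taylor_remainder_isBigO {N : ℕ} (hu : ContDiffAt ℝ N u x₀) :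
    (fun p : ℝ × ℝ => u p.2 - ∑ l ∈ range N, iteratedDeriv l u p.1 * (p.2 - p.1) ^ l / l !)
      =O[𝓝 (x₀, x₀)] fun p => (p.2 - p.1) ^ N := by
  rcases N with _ | N
  · simpa [Function.comp_def] using
      (hu.continuousAt.tendsto.comp (continuous_snd.tendsto (x₀, x₀))).isBigO_one ℝ
  obtain ⟨M, hM⟩ := ((contDiffAt_iteratedDeriv (m := 0) (i := N + 1) hu
    (by simp)).continuousAt.isBigO_one ℝ).bound
  have hsmooth := hu.eventually (by simp)
  obtain ⟨R, hR, hball⟩ := Metric.eventually_nhds_iff_ball.1 (hM.and hsmooth)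
  refine .of_bound M ?_
  filter_upwards [prod_mem_nhds (Metric.ball_mem_nhds x₀ hR) (Metric.ball_mem_nhds x₀ hR)]
    with ⟨a, b⟩ hab
  have hsub : uIcc a b ⊆ Metric.ball x₀ R :=
    (convex_ball x₀ R).ordConnected.uIcc_subset hab.1 hab.2
  obtain ⟨y, hy, h⟩ := taylor_mean_remainder_of_contDiffAt (fun y hy => (hball y (hsub hy)).2)
  have hbound := (hball y (hsub hy)).1
  rw [norm_one, mul_one] at hbound
  have hfact : (1 : ℝ) ≤ ‖((N + 1)! : ℝ)‖ := by
    simpa using Nat.one_le_iff_ne_zero.2 (N + 1).factorial_ne_zero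
  rw [h, norm_div, norm_mul]
  exact (div_le_self (by positivity) hfact).trans (by gcongr)

lemma isBigO_one_of_isCompact {ι : Type*} {l : Filter ι} {K : Set ℝ} (hK : IsCompact K) {f : ℝ → ℝ}
    (hf : Continuous f) : (fun q : ι × ℝ => f q.2) =O[l ×ˢ 𝓟 K] fun _ => (1 : ℝ) :=
  (hf.continuousOn.isBigO_principal hK (c := (1 : ℝ)) (by simp)).comp_tendsto tendsto_snd

lemma isBigO_intervalIntegral {ι : Type*} {l : Filter ι} {a b : ℝ} {F : ι × ℝ → ℝ} {g : ι → ℝ}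
    (hF : F =O[l ×ˢ 𝓟 (uIcc a b)] fun q => g q.1) :
    (fun i => ∫ ξ in a..b, F (i, ξ)) =O[l] g := by
  obtain ⟨c, hc⟩ := hF.bound
  refine .of_bound (c * |b - a|) ?_
  filter_upwards [eventually_prod_principal_iff.1 hc] with i hi
  rw [mul_right_comm]
  exact intervalIntegral.norm_integral_le_of_norm_le_const fun ξ hξ => hi ξ (uIoc_subset_uIcc hξ)

variable {ι : Type*} {l : Filter ι}

lemma tendsto_neg_nhdsNE_zero {h : ι → ℝ} (hh : Tendsto h l (𝓝[≠] 0)) :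
    Tendsto (fun i => -h i) l (𝓝[≠] 0) := by
  refine tendsto_nhdsWithin_iff.2
    ⟨by simpa using (tendsto_nhds_of_tendsto_nhdsWithin hh).neg, ?_⟩
  filter_upwards [hh self_mem_nhdsWithin] with i hi using neg_ne_zero.2 hi

lemma isBigO_pow_of_le {h : ι → ℝ} {m n : ℕ} (hh : Tendsto h l (𝓝 0)) (hmn : m ≤ n) :
    (fun i => h i ^ n) =O[l] fun i => h i ^ m := by
  refine .of_bound 1 ?_
  filter_upwards [hh.norm.eventually_le_const (by simp : ‖(0 : ℝ)‖ < 1)] with i hi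
  rw [norm_pow, norm_pow, one_mul]
  exact pow_le_pow_of_le_one (norm_nonneg _) hi hmn

lemma isBigO_second_difference {f : ℝ → ℝ} {y₀ : ℝ} (hf : ContDiffAt ℝ 2 f y₀) {a b e : ι → ℝ}
    (ha : Tendsto a l (𝓝 y₀)) (hb : Tendsto b l (𝓝 y₀)) (he : Tendsto e l (𝓝 0)) :
    (fun i => f (a i + e i) - f (a i) - (f (b i + e i) - f (b i)))
      =O[l] fun i => e i * (a i - b i) := by
  have hf' : ContDiffAt ℝ 1 (deriv f) y₀ := by
    simpa using contDiffAt_iteratedDeriv (m := 1) (i := 1) hf (by norm_num)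
  obtain ⟨L, s, hs, hL⟩ := hf'.exists_lipschitzOnWith
  have hdiff : ∀ᶠ y in 𝓝 y₀, DifferentiableAt ℝ f y :=
    (hf.eventually (by simp)).mono fun y hy => hy.differentiableAt (by simp)
  obtain ⟨R, hR, hball⟩ := Metric.eventually_nhds_iff_ball.1 (hdiff.and hs)
  have hae := ha.add he
  have hbe := hb.add he
  rw [add_zero] at hae hbe
  refine .of_bound L ?_
  have hmem := Metric.ball_mem_nhds y₀ hR
  filter_upwards [ha hmem, hb hmem, hae hmem, hbe hmem] with i hai hbi haei hbei
  have hsub : uIcc (b i) (a i) ⊆ Metric.ball y₀ R :=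
    (convex_ball y₀ R).ordConnected.uIcc_subset hbi hai
  have hsub_add : ∀ z ∈ uIcc (b i) (a i), z + e i ∈ Metric.ball y₀ R := fun z hz =>
    (convex_ball y₀ R).ordConnected.uIcc_subset hbei haei
      (by simpa using mem_image_of_mem (· + e i) hz)
  have hderiv : ∀ z ∈ uIcc (b i) (a i), HasDerivWithinAt (fun z => f (z + e i) - f z)
      (deriv f (z + e i) - deriv f z) (uIcc (b i) (a i)) z := fun z hz =>
    (((hball _ (hsub_add z hz)).1.hasDerivAt.comp_add_const z (e i)).sub
      (hball _ (hsub hz)).1.hasDerivAt).hasDerivWithinAt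
  have hlip : ∀ z ∈ uIcc (b i) (a i), ‖deriv f (z + e i) - deriv f z‖ ≤ L * ‖e i‖ := fun z hz => by
    simpa using hL.norm_sub_le (hball _ (hsub_add z hz)).2 (hball _ (hsub hz)).2
  simpa [mul_assoc] using Convex.norm_image_sub_le_of_norm_hasDerivWithin_le hderiv hlip
    (convex_uIcc _ _) left_mem_uIcc right_mem_uIcc

lemma isBigO_perturbation_sub {f : ℝ → ℝ} {y₀ : ℝ} (hf : ContDiffAt ℝ 2 f y₀)
    {a b e e' h H : ι → ℝ} (ha : Tendsto a l (𝓝 y₀)) (hb : Tendsto b l (𝓝 y₀))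
    (hH : Tendsto H l (𝓝 0)) (hab : (fun i => a i - b i) =O[l] h) (he : e =O[l] H)
    (he' : e' =O[l] H) (hee' : (fun i => e i - e' i) =O[l] fun i => H i * h i) :
    (fun i => f (a i + e i) - f (a i) - (f (b i + e' i) - f (b i)))
      =O[l] fun i => H i * h i := by
  have h_swap := (isBigO_second_difference hf ha hb (he.trans_tendsto hH)).trans (he.mul hab)
  have hbe := hb.add (he.trans_tendsto hH)
  have hbe' := hb.add (he'.trans_tendsto hH)
  rw [add_zero] at hbe hbe'
  have hstrict := (hf.hasStrictDerivAt (by simp)).hasStrictFDerivAt.isBigO_sub.comp_tendsto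
    (hbe.prodMk_nhds hbe')
  have h_last : (fun i => f (b i + e i) - f (b i + e' i)) =O[l] fun i => H i * h i := by
    refine .trans ?_ hee'
    simpa [Function.comp_def] using hstrict
  exact (h_swap.add h_last).congr_left fun i => by ring

end Analysis

open Polynomial (C X derivative)
open scoped fwdDiff

section Reconstruction

/-- The cell averages of the derivative of the polynomial `Q`. -/
noncomputable def cellDiff (Q : ℝ[X]) (m : ℤ) : ℝ :=
  Q.eval (m + 1 / 2 : ℝ) - Q.eval (m - 1 / 2 : ℝ)

lemma sum_range_cellDiff (Q : ℝ[X]) (a : ℤ) (i : ℕ) :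
    ∑ q ∈ range i, cellDiff Q (a + q) = Q.eval (a - 1 / 2 + i : ℝ) - Q.eval (a - 1 / 2 : ℝ) := by
  have htel := Finset.sum_range_sub (fun q : ℕ => Q.eval (a - 1 / 2 + q : ℝ)) i
  rw [Nat.cast_zero, add_zero] at htel
  rw [← htel]
  refine sum_congr rfl fun q _ => ?_
  rw [cellDiff]
  push_cast
  congr 2 <;> ring

lemma injOn_interfaces (N : ℕ) (a : ℝ) :
    InjOn (fun i : ℕ => a - 1 / 2 + (i : ℝ)) (range (N + 1)) := fun i _ j _ hij => by
  simpa using hij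

/-- The interpolant of the primitive of the data, of which `reconPoly` is the derivative. -/
noncomputable def reconPrimitive (N : ℕ) (a : ℤ) (v : ℤ → ℝ) : ℝ[X] :=
  Lagrange.interpolate (range (N + 1)) (fun i : ℕ => (a : ℝ) - 1 / 2 + i)
    (fun i : ℕ => ∑ q ∈ range i, v (a + q))

lemma natDegree_reconPrimitive_le (N : ℕ) (a : ℤ) (v : ℤ → ℝ) :
    (reconPrimitive N a v).natDegree ≤ N := by
  have hdegree := Lagrange.degree_interpolate_le (fun i : ℕ => ∑ q ∈ range i, v (a + q))
    (injOn_interfaces N a)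
  rw [Finset.card_range, Nat.add_sub_cancel] at hdegree
  exact Polynomial.natDegree_le_of_degree_le hdegree

lemma eval_reconPrimitive_cellDiff {N i : ℕ} (hi : i ≤ N) (a : ℤ) (Q : ℝ[X]) :
    (reconPrimitive N a (cellDiff Q)).eval (a - 1 / 2 + i : ℝ) =
      Q.eval (a - 1 / 2 + i : ℝ) - Q.eval (a - 1 / 2 : ℝ) := by
  rw [← sum_range_cellDiff]
  exact Lagrange.eval_interpolate_at_node _ (injOn_interfaces N a)
    (Finset.mem_range.2 (Nat.lt_succ_of_le hi))

theorem reconPoly_cellDiff {N : ℕ} (a : ℤ) {Q : ℝ[X]} (hQ : Q.natDegree ≤ N) :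
    reconPoly N a (cellDiff Q) = derivative Q := by
  have hprim : Q - C (Q.eval (a - 1 / 2 : ℝ)) = reconPrimitive N a (cellDiff Q) := by
    refine Lagrange.eq_interpolate_of_eval_eq _ (injOn_interfaces N a) ?_ fun i _ => ?_
    · rw [Finset.card_range]
      refine Polynomial.degree_le_natDegree.trans_lt ?_
      rw [Polynomial.natDegree_sub_C]
      exact_mod_cast Nat.lt_succ_of_le hQ
    · rw [sum_range_cellDiff, Polynomial.eval_sub, Polynomial.eval_C]
  rw [show reconPoly N a (cellDiff Q) = derivative (reconPrimitive N a (cellDiff Q)) from rfl,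
    ← hprim, Polynomial.derivative_sub, Polynomial.derivative_C, sub_zero]

lemma reconPoly_eq_sum (N : ℕ) (a : ℤ) (v : ℤ → ℝ) :
    reconPoly N a v = ∑ i ∈ range (N + 1), C (∑ q ∈ range i, v (a + q)) *
      derivative (Lagrange.basis (range (N + 1)) (fun i : ℕ => (a : ℝ) - 1 / 2 + i) i) := by
  rw [reconPoly, Lagrange.interpolate_apply, Polynomial.derivative_sum]
  exact sum_congr rfl fun i _ => Polynomial.derivative_C_mul _ _

lemma isLinearMap_reconPoly (N : ℕ) (a : ℤ) : IsLinearMap ℝ (reconPoly N a) where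
  map_add v w := by
    simp only [reconPoly_eq_sum, Pi.add_apply, Finset.sum_add_distrib, Polynomial.C_add, add_mul]
  map_smul c v := by
    simp only [reconPoly_eq_sum, Pi.smul_apply, smul_eq_mul, ← Finset.mul_sum, Polynomial.C_mul,
      mul_assoc, Polynomial.smul_eq_C_mul]

variable {r : ℕ} {s : Fin r}

lemma subPoly_cellDiff {Q : ℝ[X]} (hQ : Q.natDegree ≤ r) :
    subPoly r s (cellDiff Q) = derivative Q :=
  reconPoly_cellDiff _ hQ

lemma isLinearMap_subPoly : IsLinearMap ℝ (subPoly r s) :=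
  isLinearMap_reconPoly _ _

lemma isLinearMap_subValue : IsLinearMap ℝ (subValue r s) where
  map_add v w := by simp only [subValue, isLinearMap_subPoly.map_add, Polynomial.eval_add]
  map_smul c v := by simp only [subValue, isLinearMap_subPoly.map_smul, Polynomial.eval_smul]

variable {ι : Type*} {l : Filter ι} {e : ι → ℤ → ℝ} {g : ι → ℝ}

lemma iterate_derivative_reconPoly_isBigO (N : ℕ) (a : ℤ) (j : ℕ) {K : Set ℝ} (hK : IsCompact K)
    (he : ∀ m, (e · m) =O[l] g) :
    (fun q : ι × ℝ => (derivative^[j] (reconPoly N a (e q.1))).eval q.2)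
      =O[l ×ˢ 𝓟 K] fun q => g q.1 := by
  simp only [reconPoly_eq_sum, Polynomial.iterate_derivative_sum, Polynomial.eval_finsetSum,
    Polynomial.iterate_derivative_C_mul, Polynomial.eval_C_mul]
  refine IsBigO.fun_sum fun i _ => ?_
  have hdata : (fun q : ι × ℝ => ∑ m ∈ range i, e q.1 (a + m)) =O[l ×ˢ 𝓟 K] fun q => g q.1 :=
    (IsBigO.fun_sum fun (m : ℕ) _ => he (a + m)).comp_tendsto (tendsto_fst (g := 𝓟 K))
  simpa using hdata.mul (isBigO_one_of_isCompact hK (Polynomial.continuous _))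

lemma subValue_isBigO (he : ∀ m, (e · m) =O[l] g) : (fun i => subValue r s (e i)) =O[l] g :=
  (iterate_derivative_reconPoly_isBigO r ((s : ℤ) - r + 1) 0 isCompact_singleton he).comp_tendsto
    (tendsto_id.prodMk (tendsto_principal.2 (.of_forall fun _ => mem_singleton (1 / 2 : ℝ))))

end Reconstruction

section OptimalWeights

section Slope

variable {R : Type*} [CommRing R]

/-- The polynomial `(Q (c + y) - Q c) / y` in the increment `y`. -/
noncomputable def slopePoly (c : R) (Q : R[X]) : R[X] :=
  (Polynomial.taylor c Q).divX

lemma eval_slopePoly_mul (c : R) (Q : R[X]) (y : R) :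
    (slopePoly c Q).eval y * y = Q.eval (y + c) - Q.eval c := by
  have h := congrArg (Polynomial.eval y) (Polynomial.divX_mul_X_add (Polynomial.taylor c Q))
  rw [Polynomial.eval_add, Polynomial.eval_mul, Polynomial.eval_X, Polynomial.eval_C,
    Polynomial.taylor_coeff_zero, Polynomial.taylor_eval] at h
  exact eq_sub_of_add_eq h

lemma eval_zero_slopePoly (c : R) (Q : R[X]) : (slopePoly c Q).eval 0 = (derivative Q).eval c := by
  rw [slopePoly, ← Polynomial.coeff_zero_eq_eval_zero, Polynomial.coeff_divX,
    Polynomial.taylor_coeff_one]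

lemma slopePoly_add (c : R) (Q S : R[X]) :
    slopePoly c (Q + S) = slopePoly c Q + slopePoly c S := by
  rw [slopePoly, map_add, Polynomial.divX_add, slopePoly, slopePoly]

lemma natDegree_slopePoly (c : R) (Q : R[X]) : (slopePoly c Q).natDegree = Q.natDegree - 1 := by
  rw [slopePoly, Polynomial.natDegree_divX_eq_natDegree_tsub_one, Polynomial.natDegree_taylor]

/-- All nodes of the difference but `y = 0` are zeros of the slope polynomial of `Q - S`. -/
lemma fwdDiff_iter_slopePoly_of_interpolates [IsDomain R] [CharZero R] {N j : ℕ} (hN : 0 < N)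
    (hj : j ≤ N) {c : R} {Q S : R[X]} (hS : S.natDegree ≤ N)
    (h : ∀ i ≤ N, (Q - S).eval ((i : R) - j + c) = (Q - S).eval c) :
    (Δ_[1])^[N] (slopePoly c Q).eval (-j : R) =
      (-1) ^ (N - j) * N.choose j * (derivative (Q - S)).eval c := by
  have hsplit : (slopePoly c Q).eval = (slopePoly c (Q - S)).eval + (slopePoly c S).eval := by
    funext y
    rw [Pi.add_apply, ← Polynomial.eval_add, ← slopePoly_add, sub_add_cancel]
  rw [hsplit, fwdDiff_iter_add, Polynomial.fwdDiff_iter_eq_zero_of_degree_lt (P := slopePoly c S)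
    (by rw [natDegree_slopePoly]; omega), add_zero, fwdDiff_iter_eq_sum_shift,
    Finset.sum_eq_single_of_mem j (Finset.mem_range.2 (by omega))]
  · rw [nsmul_one, neg_add_cancel, eval_zero_slopePoly, zsmul_eq_mul]
    push_cast
    rfl
  · intro i hi hij
    have hy : (i : R) - j ≠ 0 := sub_ne_zero.2 (Nat.cast_injective.ne hij)
    have hroot := eval_slopePoly_mul c (Q - S) ((i : R) - j)
    rw [h i (Nat.lt_succ_iff.1 (Finset.mem_range.1 hi)), sub_self] at hroot
    rw [nsmul_one, neg_add_eq_sub, (mul_eq_zero.1 hroot).resolve_right hy, smul_zero]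

end Slope

variable {r : ℕ}

lemma optWeight_pos (s : Fin r) : 0 < optWeight r s := by
  have hs := s.is_lt
  have h1 := Nat.choose_pos hs.le
  have h2 := Nat.choose_pos (show (s : ℕ) ≤ r - 1 by omega)
  have h3 := Nat.choose_pos (show r ≤ 2 * r - 1 by omega)
  rw [optWeight]
  positivity

lemma sum_optWeight (hr : 0 < r) : ∑ s, optWeight r s = 1 := by
  have hvandermonde : ((2 * r - 1).choose r : ℝ) =
      ∑ s ∈ range r, (r.choose s : ℝ) * ((r - 1).choose s) := by
    rw [show 2 * r - 1 = (r - 1) + r by omega, Nat.add_choose_eq,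
      Finset.Nat.sum_antidiagonal_eq_sum_range_succ_mk, Finset.sum_range_succ,
      Nat.choose_eq_zero_of_lt (Nat.sub_lt hr one_pos), zero_mul, add_zero, Nat.cast_sum]
    refine sum_congr rfl fun s hs => ?_
    rw [Nat.choose_symm (Finset.mem_range.1 hs).le, Nat.cast_mul, mul_comm]
  have hpos : 0 < (2 * r - 1).choose r := Nat.choose_pos (by omega)
  simp only [optWeight]
  rw [← Finset.sum_div,
    Fin.sum_univ_eq_sum_range (fun s => (r.choose s : ℝ) * ((r - 1).choose s)), ← hvandermonde]
  exact div_self (by positivity)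

lemma optWeight_lt_one (hr : 2 ≤ r) (s : Fin r) : optWeight r s < 1 := by
  rw [← sum_optWeight (r := r) (by omega)]
  have : Nontrivial (Fin r) := Fin.nontrivial_iff_two_le.2 hr
  obtain ⟨t, ht⟩ := exists_ne s
  exact Finset.single_lt_sum ht (Finset.mem_univ s) (Finset.mem_univ t) (optWeight_pos t)
    fun j _ _ => (optWeight_pos j).le

/-- The derivative at `1 / 2` of the primitive is read off from the `r`-th difference of the
slopes through the interface `1 / 2`, which is one of the interpolation nodes. -/
lemma fwdDiff_iter_slopePoly_eq_subValue_error (s : Fin r) (Q : ℝ[X]) :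
    (Δ_[1])^[r] (slopePoly (1 / 2) Q).eval (s - r : ℝ) =
      (-1) ^ (s : ℕ) * r.choose s *
        ((derivative Q).eval (1 / 2) - subValue r s (cellDiff Q)) := by
  have hs := s.is_lt
  have hcast : ((r - s : ℕ) : ℝ) = r - s := Nat.cast_sub hs.le
  have hnode (i : ℕ) (hi : i ≤ r) :
      (Q - reconPrimitive r ((s : ℤ) - r + 1) (cellDiff Q)).eval ((i : ℝ) - (r - s : ℕ) + 1 / 2) =
        Q.eval ((s : ℝ) - r + 1 / 2) := by
    have h := eval_reconPrimitive_cellDiff hi ((s : ℤ) - r + 1) Q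
    push_cast at h
    rw [hcast, Polynomial.eval_sub]
    ring_nf at h ⊢
    linarith
  have h := fwdDiff_iter_slopePoly_of_interpolates (by omega) (Nat.sub_le r s)
    (natDegree_reconPrimitive_le r ((s : ℤ) - r + 1) (cellDiff Q))
    fun i hi => (hnode i hi).trans (by simpa using (hnode (r - s) (Nat.sub_le r s)).symm)
  rwa [Nat.sub_sub_self hs.le, Nat.choose_symm hs.le, hcast, neg_sub, Polynomial.derivative_sub,
    Polynomial.eval_sub] at h

lemma sum_alternating_choose_mul (M : ℕ) (g : ℝ → ℝ) (y : ℝ) :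
    ∑ s ∈ range (M + 1), (-1) ^ s * (M.choose s : ℝ) * g (s + y) =
      (-1) ^ M * (Δ_[1])^[M] g y := by
  rw [fwdDiff_iter_eq_sum_shift, Finset.mul_sum]
  refine sum_congr rfl fun s hs => ?_
  have hsign : (-1 : ℝ) ^ M * (-1) ^ (M - s) = (-1) ^ s := by
    obtain ⟨t, rfl⟩ := Nat.exists_eq_add_of_le (Nat.lt_succ_iff.1 (Finset.mem_range.1 hs))
    rw [Nat.add_sub_cancel_left, pow_add, mul_assoc, ← mul_pow, neg_one_mul, neg_neg, one_pow,
      mul_one]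
  rw [zsmul_eq_mul, nsmul_one, ← hsign, add_comm y]
  push_cast
  ring

theorem sum_optWeight_mul_subValue_cellDiff (hr : 0 < r) {Q : ℝ[X]}
    (hQ : Q.natDegree ≤ 2 * r - 1) :
    ∑ s, optWeight r s * subValue r s (cellDiff Q) = (derivative Q).eval (1 / 2) := by
  have hdiff : (Δ_[1])^[r - 1] ((Δ_[1])^[r] (slopePoly (1 / 2) Q).eval) (-r : ℝ) = 0 := by
    rw [← Function.iterate_add_apply, Polynomial.fwdDiff_iter_eq_zero_of_degree_lt
      (by rw [natDegree_slopePoly]; omega), Pi.zero_apply]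
  have hterm (s : Fin r) :
      optWeight r s * ((derivative Q).eval (1 / 2) - subValue r s (cellDiff Q)) =
        ((2 * r - 1).choose r : ℝ)⁻¹ * ((-1) ^ (s : ℕ) * ((r - 1).choose s : ℝ) *
          (Δ_[1])^[r] (slopePoly (1 / 2) Q).eval (s + -r : ℝ)) := by
    have hsign : ((-1 : ℝ) ^ (s : ℕ)) ^ 2 = 1 := by rw [← pow_mul, mul_comm, pow_mul]; simp
    rw [← sub_eq_add_neg, fwdDiff_iter_slopePoly_eq_subValue_error, optWeight, div_eq_mul_inv]
    linear_combination (-(r.choose s : ℝ) * (r - 1).choose s * ((2 * r - 1).choose r : ℝ)⁻¹ *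
      ((derivative Q).eval (1 / 2) - subValue r s (cellDiff Q))) * hsign
  have herror :
      ∑ s, optWeight r s * ((derivative Q).eval (1 / 2) - subValue r s (cellDiff Q)) = 0 := by
    rw [sum_congr rfl fun s _ => hterm s, ← Finset.mul_sum, Fin.sum_univ_eq_sum_range (fun s =>
      (-1) ^ s * ((r - 1).choose s : ℝ) * (Δ_[1])^[r] (slopePoly (1 / 2) Q).eval (s + -r : ℝ)) r]
    have halt := sum_alternating_choose_mul (r - 1) ((Δ_[1])^[r] (slopePoly (1 / 2) Q).eval) (-r)
    rw [Nat.sub_add_cancel hr] at halt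
    rw [halt, hdiff, mul_zero, mul_zero]
  simp only [mul_sub, Finset.sum_sub_distrib, ← Finset.sum_mul, sum_optWeight hr, one_mul]
    at herror
  exact (sub_eq_zero.1 herror).symm

end OptimalWeights

section TaylorData

/-- The Taylor polynomial of degree less than `N` of `ξ ↦ u (x + h * ξ)` at `0`. -/
noncomputable def taylorPoly (u : ℝ → ℝ) (N : ℕ) (h x : ℝ) : ℝ[X] :=
  ∑ l ∈ range N, C (iteratedDeriv l u x * h ^ l / l !) * X ^ l

/-- The primitive of `taylorPoly` that vanishes at `0`. -/
noncomputable def taylorPrimitive (u : ℝ → ℝ) (N : ℕ) (h x : ℝ) : ℝ[X] :=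
  ∑ l ∈ range N, C (iteratedDeriv l u x * h ^ l / (l + 1)!) * X ^ (l + 1)

lemma natDegree_taylorPrimitive_le (u : ℝ → ℝ) (N : ℕ) (h x : ℝ) :
    (taylorPrimitive u N h x).natDegree ≤ N :=
  Polynomial.natDegree_sum_le_of_forall_le _ _ fun _ hl =>
    (Polynomial.natDegree_C_mul_X_pow_le _ _).trans (Finset.mem_range.1 hl)

lemma derivative_taylorPrimitive (u : ℝ → ℝ) (N : ℕ) (h x : ℝ) :
    derivative (taylorPrimitive u N h x) = taylorPoly u N h x := by
  rw [taylorPrimitive, taylorPoly, Polynomial.derivative_sum]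
  refine sum_congr rfl fun l _ => ?_
  rw [Polynomial.derivative_C_mul_X_pow, Nat.add_sub_cancel, Nat.factorial_succ]
  push_cast
  congr 2
  field_simp

lemma derivative_taylorPoly_succ (u : ℝ → ℝ) (N : ℕ) (h x : ℝ) :
    derivative (taylorPoly u (N + 1) h x) = C h * taylorPoly (deriv u) N h x := by
  rw [taylorPoly, Polynomial.derivative_sum, Finset.sum_range_succ', pow_zero (X : ℝ[X]), mul_one,
    Polynomial.derivative_C, add_zero, taylorPoly, Finset.mul_sum]
  refine sum_congr rfl fun l _ => ?_
  rw [Polynomial.derivative_C_mul_X_pow, Nat.add_sub_cancel, iteratedDeriv_succ', ← mul_assoc,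
    ← Polynomial.C_mul, Nat.factorial_succ]
  push_cast
  congr 2
  field_simp
  ring

lemma iterate_derivative_taylorPoly (u : ℝ → ℝ) (N k : ℕ) (h x : ℝ) :
    derivative^[k] (taylorPoly u (N + k) h x) =
      C (h ^ k) * taylorPoly (iteratedDeriv k u) N h x := by
  induction k generalizing u with
  | zero => simp
  | succ k ih =>
    rw [Function.iterate_succ_apply, ← add_assoc, derivative_taylorPoly_succ,
      Polynomial.iterate_derivative_C_mul, ih, ← mul_assoc, ← Polynomial.C_mul, ← pow_succ',
      iteratedDeriv_succ']

lemma cellAvg_eq_integral (u : ℝ → ℝ) {h : ℝ} (hh : h ≠ 0) (x m : ℝ) :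
    cellAvg u h (x + m * h) = ∫ ξ in (m - 1 / 2)..(m + 1 / 2), u (x + h * ξ) := by
  rw [intervalIntegral.integral_comp_add_mul u hh, cellAvg, smul_eq_mul, one_div]
  ring_nf

lemma cellDiff_eq_integral (Q : ℝ[X]) (m : ℤ) :
    cellDiff Q m = ∫ ξ in (m - 1 / 2 : ℝ)..(m + 1 / 2), (derivative Q).eval ξ :=
  (intervalIntegral.integral_eq_sub_of_hasDerivAt (fun ξ _ => Q.hasDerivAt ξ)
    ((derivative Q).continuous.intervalIntegrable _ _)).symm

variable {ι : Type*} {l : Filter ι} {h x : ι → ℝ} {x₀ : ℝ} {u : ℝ → ℝ} {N : ℕ} {K : Set ℝ}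

lemma tendsto_add_mul_prod_principal (hK : IsCompact K) (hh : Tendsto h l (𝓝 0))
    (hx : Tendsto x l (𝓝 x₀)) :
    Tendsto (fun q : ι × ℝ => x q.1 + h q.1 * q.2) (l ×ˢ 𝓟 K) (𝓝 x₀) := by
  have hmul : Tendsto (fun q : ι × ℝ => h q.1 * q.2) (l ×ˢ 𝓟 K) (𝓝 0) :=
    ((isBigO_refl _ _).mul (isBigO_one_of_isCompact hK continuous_id)).trans_tendsto
      (by simpa [Function.comp_def] using hh.comp tendsto_fst)
  simpa using (hx.comp tendsto_fst).add hmul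

lemma sub_eval_taylorPoly_isBigO (hK : IsCompact K) (hu : ContDiffAt ℝ N u x₀)
    (hh : Tendsto h l (𝓝 0)) (hx : Tendsto x l (𝓝 x₀)) :
    (fun q : ι × ℝ => u (x q.1 + h q.1 * q.2) - (taylorPoly u N (h q.1) (x q.1)).eval q.2)
      =O[l ×ˢ 𝓟 K] fun q => h q.1 ^ N := by
  have htaylor := (taylor_remainder_isBigO hu).comp_tendsto
    ((hx.comp tendsto_fst).prodMk_nhds (tendsto_add_mul_prod_principal hK hh hx))
  have hpow : (fun q : ι × ℝ => (h q.1 * q.2) ^ N) =O[l ×ˢ 𝓟 K] fun q => h q.1 ^ N := by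
    simpa only [mul_pow, mul_one] using
      (isBigO_refl _ _).mul (isBigO_one_of_isCompact hK (continuous_pow N))
  refine (htaylor.congr (fun q => ?_) fun q => ?_).trans hpow
  · simp only [Function.comp_apply, add_sub_cancel_left, taylorPoly, Polynomial.eval_finsetSum,
      Polynomial.eval_mul, Polynomial.eval_C, Polynomial.eval_pow, Polynomial.eval_X]
    congr 1
    exact sum_congr rfl fun l _ => by ring
  · simp only [Function.comp_apply, add_sub_cancel_left]

theorem cellAvg_sub_cellDiff_isBigO (hu : ContDiffAt ℝ N u x₀) (hh : Tendsto h l (𝓝[≠] 0))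
    (hx : Tendsto x l (𝓝 x₀)) (m : ℤ) :
    (fun i => cellAvg u (h i) (x i + m * h i) - cellDiff (taylorPrimitive u N (h i) (x i)) m)
      =O[l] fun i => h i ^ N := by
  have hh0 := tendsto_nhds_of_tendsto_nhdsWithin hh
  have hK : IsCompact (uIcc (m - 1 / 2 : ℝ) (m + 1 / 2)) := isCompact_uIcc
  have hcont : ∀ᶠ i in l, ∀ ξ ∈ uIcc (m - 1 / 2 : ℝ) (m + 1 / 2),
      ContinuousAt u (x i + h i * ξ) :=
    eventually_prod_principal_iff.1 <| (tendsto_add_mul_prod_principal hK hh0 hx).eventually <|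
      (hu.eventually (by simp)).mono fun _ hy => hy.continuousAt
  refine (isBigO_intervalIntegral (sub_eval_taylorPoly_isBigO hK hu hh0 hx)).congr' ?_ .rfl
  filter_upwards [hcont, hh (self_mem_nhdsWithin)] with i hcont_i hi
  have hint : IntervalIntegrable (fun ξ => u (x i + h i * ξ)) MeasureTheory.volume
      (m - 1 / 2 : ℝ) (m + 1 / 2) :=
    ContinuousOn.intervalIntegrable fun ξ hξ =>
      (ContinuousAt.comp (f := fun ξ => x i + h i * ξ) (hcont_i ξ hξ)
        (by fun_prop)).continuousWithinAt
  rw [intervalIntegral.integral_sub hint ((Polynomial.continuous _).intervalIntegrable _ _),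
    cellAvg_eq_integral u hi, cellDiff_eq_integral, derivative_taylorPrimitive]

end TaylorData

section SmoothnessIndicators

/-- The Jiang–Shu indicator of a polynomial on the reference cell: `smoothInd r v s` is its value
at `subPoly r s v`. -/
noncomputable def polyInd (r : ℕ) (p : ℝ[X]) : ℝ :=
  ∑ j ∈ Finset.Icc 1 (r - 1), ∫ ξ in (-(1 / 2) : ℝ)..(1 / 2), ((derivative^[j] p).eval ξ) ^ 2

lemma intervalIntegrable_eval_sq (p : ℝ[X]) (a b : ℝ) :
    IntervalIntegrable (fun ξ => p.eval ξ ^ 2) MeasureTheory.volume a b :=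
  (p.continuous.pow 2).intervalIntegrable _ _

lemma integral_sq_nonneg (f : ℝ → ℝ) : 0 ≤ ∫ ξ in (-(1 / 2) : ℝ)..(1 / 2), f ξ ^ 2 :=
  intervalIntegral.integral_nonneg (by norm_num) fun _ _ => sq_nonneg _

lemma polyInd_nonneg (r : ℕ) (p : ℝ[X]) : 0 ≤ polyInd r p :=
  Finset.sum_nonneg fun _ _ => integral_sq_nonneg _

lemma abs_add_sq_sub_sq_le (a e : ℝ) {η : ℝ} (hη : 0 < η) :
    |(a + e) ^ 2 - a ^ 2| ≤ η * a ^ 2 + (1 + η⁻¹) * e ^ 2 := by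
  have hyoung : |2 * a * e| ≤ η * a ^ 2 + η⁻¹ * e ^ 2 := by
    have h := two_mul_le_add_sq (√η * |a|) ((√η)⁻¹ * |e|)
    have hsqrt : √η ≠ 0 := (Real.sqrt_pos.2 hη).ne'
    rw [mul_pow, mul_pow, inv_pow, Real.sq_sqrt hη.le, sq_abs, sq_abs] at h
    rw [abs_mul, abs_mul, abs_two]
    refine le_of_eq_of_le ?_ h
    field_simp
  calc |(a + e) ^ 2 - a ^ 2| = |2 * a * e + e ^ 2| := by ring_nf
    _ ≤ |2 * a * e| + e ^ 2 := (abs_add_le _ _).trans_eq (by rw [abs_sq])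
    _ ≤ η * a ^ 2 + (1 + η⁻¹) * e ^ 2 := by linarith

lemma abs_polyInd_add_sub_le (r : ℕ) (p q : ℝ[X]) {η : ℝ} (hη : 0 < η) :
    |polyInd r (p + q) - polyInd r p| ≤ η * polyInd r p + (1 + η⁻¹) * polyInd r q := by
  have hintegral (p q : ℝ[X]) :
      |∫ ξ in (-(1 / 2) : ℝ)..(1 / 2), ((p + q).eval ξ ^ 2 - p.eval ξ ^ 2)|
        ≤ ∫ ξ in (-(1 / 2) : ℝ)..(1 / 2), (η * p.eval ξ ^ 2 + (1 + η⁻¹) * q.eval ξ ^ 2) := by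
    refine (intervalIntegral.abs_integral_le_integral_abs (by norm_num)).trans ?_
    refine intervalIntegral.integral_mono_on (by norm_num)
      ((intervalIntegrable_eval_sq _ _ _).sub (intervalIntegrable_eval_sq _ _ _)).abs
      (((intervalIntegrable_eval_sq _ _ _).const_mul _).add
        ((intervalIntegrable_eval_sq _ _ _).const_mul _)) fun ξ _ => ?_
    rw [Polynomial.eval_add]
    exact abs_add_sq_sub_sq_le _ _ hη
  simp only [polyInd, Finset.mul_sum, ← Finset.sum_sub_distrib, ← Finset.sum_add_distrib]
  refine (Finset.abs_sum_le_sum_abs _ _).trans (Finset.sum_le_sum fun j _ => ?_)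
  rw [← intervalIntegral.integral_sub (intervalIntegrable_eval_sq _ _ _)
    (intervalIntegrable_eval_sq _ _ _), ← intervalIntegral.integral_const_mul,
    ← intervalIntegral.integral_const_mul, ← intervalIntegral.integral_add
      ((intervalIntegrable_eval_sq _ _ _).const_mul _)
      ((intervalIntegrable_eval_sq _ _ _).const_mul _), iterate_map_add]
  exact hintegral _ _

variable {ι : Type*} {l : Filter ι} {r k : ℕ} {h x : ι → ℝ}

lemma polyInd_isBigO {p : ι → ℝ[X]} {g : ι → ℝ}
    (hp : ∀ j, (fun q : ι × ℝ => (derivative^[j] (p q.1)).eval q.2)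
      =O[l ×ˢ 𝓟 (uIcc (-(1 / 2)) (1 / 2))] fun q => g q.1) :
    (fun i => polyInd r (p i)) =O[l] fun i => g i ^ 2 :=
  IsBigO.fun_sum fun j _ => isBigO_intervalIntegral (g := fun i => g i ^ 2) ((hp j).pow 2)

lemma eventually_le_integral_sq {p : ι → ℝ[X]} {c : ℝ} (hc : c ≠ 0)
    (hp : Tendsto (fun q : ι × ℝ => (p q.1).eval q.2) (l ×ˢ 𝓟 (uIcc (-(1 / 2)) (1 / 2))) (𝓝 c)) :
    ∀ᶠ i in l, c ^ 2 / 2 ≤ ∫ ξ in (-(1 / 2) : ℝ)..(1 / 2), (p i).eval ξ ^ 2 := by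
  have hlower : ∀ᶠ q in l ×ˢ 𝓟 (uIcc (-(1 / 2)) (1 / 2)),
      c ^ 2 / 2 < (p q.1).eval q.2 ^ 2 :=
    (hp.pow 2).eventually_const_lt (half_lt_self (by positivity))
  filter_upwards [eventually_prod_principal_iff.1 hlower] with i hi
  have hconst : ∫ _ in (-(1 / 2) : ℝ)..(1 / 2), c ^ 2 / 2 = c ^ 2 / 2 := by
    rw [intervalIntegral.integral_const, smul_eq_mul]
    ring
  rw [← hconst]
  exact intervalIntegral.integral_mono_on (by norm_num) (by simp)
    (intervalIntegrable_eval_sq _ _ _) fun ξ hξ => (hi ξ (Icc_subset_uIcc hξ)).le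

theorem pow_isBigO_polyInd_taylorPoly {u : ℝ → ℝ} {x₀ : ℝ} (hk : 1 ≤ k) (hkr : k < r)
    (hu : ContDiffAt ℝ r u x₀) (hne : iteratedDeriv k u x₀ ≠ 0) (hh : Tendsto h l (𝓝 0))
    (hx : Tendsto x l (𝓝 x₀)) :
    (fun i => h i ^ (2 * k)) =O[l] fun i => polyInd r (taylorPoly u r (h i) (x i)) := by
  obtain ⟨N, rfl⟩ := Nat.exists_eq_add_of_le' hkr.le
  have hN : N ≠ 0 := by omega
  have hK : IsCompact (uIcc (-(1 / 2) : ℝ) (1 / 2)) := isCompact_uIcc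
  have huk : ContDiffAt ℝ N (iteratedDeriv k u) x₀ :=
    contDiffAt_iteratedDeriv hu (by exact_mod_cast le_rfl)
  have hpow : Tendsto (fun q : ι × ℝ => h q.1 ^ N)
      (l ×ˢ 𝓟 (uIcc (-(1 / 2) : ℝ) (1 / 2))) (𝓝 0) := by
    simpa [hN] using (hh.comp tendsto_fst).pow N
  have hlim : Tendsto
      (fun q : ι × ℝ => (taylorPoly (iteratedDeriv k u) N (h q.1) (x q.1)).eval q.2)
      (l ×ˢ 𝓟 (uIcc (-(1 / 2) : ℝ) (1 / 2))) (𝓝 (iteratedDeriv k u x₀)) := by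
    simpa [Function.comp_def] using
      (huk.continuousAt.tendsto.comp (tendsto_add_mul_prod_principal hK hh hx)).sub
        ((sub_eval_taylorPoly_isBigO hK huk hh hx).trans_tendsto hpow)
  refine .of_bound (iteratedDeriv k u x₀ ^ 2 / 2)⁻¹ ?_
  filter_upwards [eventually_le_integral_sq (p := fun i =>
    taylorPoly (iteratedDeriv k u) N (h i) (x i)) hne hlim] with i hi
  have hterm := Finset.single_le_sum (f := fun j => ∫ ξ in (-(1 / 2) : ℝ)..(1 / 2),
    ((derivative^[j] (taylorPoly u (N + k) (h i) (x i))).eval ξ) ^ 2)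
    (fun j _ => integral_sq_nonneg _) (Finset.mem_Icc.2 ⟨hk, Nat.le_sub_one_of_lt hkr⟩)
  simp only [iterate_derivative_taylorPoly, Polynomial.eval_C_mul, mul_pow,
    intervalIntegral.integral_const_mul] at hterm
  rw [Real.norm_of_nonneg ((even_two_mul k).pow_nonneg _), ← div_eq_inv_mul,
    le_div_iff₀ (by positivity), pow_mul']
  exact (mul_le_mul_of_nonneg_left hi (sq_nonneg _)).trans (hterm.trans (le_abs_self _))

lemma polyInd_add_sub_isBigO {p q : ι → ℝ[X]} {η : ι → ℝ} (hη : Tendsto η l (𝓝[≠] 0))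
    (hq : (fun i => polyInd r (q i)) =O[l] fun i => η i ^ 2 * polyInd r (p i)) :
    (fun i => polyInd r (p i + q i) - polyInd r (p i)) =O[l] fun i => η i * polyInd r (p i) := by
  obtain ⟨c, hbound⟩ := hq.bound
  refine .of_bound (1 + 2 * c) ?_
  have hsmall : ∀ᶠ i in l, |η i| < 1 := by
    simpa using (tendsto_nhds_of_tendsto_nhdsWithin hη).abs.eventually_lt_const (by simp)
  filter_upwards [hbound, hη self_mem_nhdsWithin, hsmall] with i hi hηi hηi1
  have hη0 : 0 < |η i| := abs_pos.2 hηi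
  have hp0 := polyInd_nonneg r (p i)
  rw [norm_mul, norm_pow, Real.norm_of_nonneg (polyInd_nonneg _ _), Real.norm_of_nonneg hp0,
    Real.norm_eq_abs] at hi
  rw [norm_mul, Real.norm_of_nonneg hp0, Real.norm_eq_abs, Real.norm_eq_abs]
  calc |polyInd r (p i + q i) - polyInd r (p i)|
      ≤ |η i| * polyInd r (p i) + (1 + |η i|⁻¹) * polyInd r (q i) :=
        abs_polyInd_add_sub_le r _ _ hη0
    _ ≤ |η i| * polyInd r (p i) + (|η i|⁻¹ + |η i|⁻¹) * (c * (|η i| ^ 2 * polyInd r (p i))) := by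
        gcongr
        · exact polyInd_nonneg _ _
        · exact (one_le_inv₀ hη0).2 hηi1.le
    _ = (1 + 2 * c) * (|η i| * polyInd r (p i)) := by
        field_simp
        ring

theorem smoothInd_sub_polyInd_isBigO {v : ι → ℤ → ℝ} {Q : ι → ℝ[X]} (hkr : k < r)
    (hh : Tendsto h l (𝓝[≠] 0)) (hQ : ∀ i, (Q i).natDegree ≤ r)
    (hv : ∀ m, (fun i => v i m - cellDiff (Q i) m) =O[l] fun i => h i ^ r)
    (hB : (fun i => h i ^ (2 * k)) =O[l] fun i => polyInd r (derivative (Q i))) (s : Fin r) :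
    (fun i => smoothInd r (v i) s - polyInd r (derivative (Q i)))
      =O[l] fun i => h i ^ (r - k) * polyInd r (derivative (Q i)) := by
  have hsplit (i : ι) : polyInd r (derivative (Q i) + subPoly r s (v i - cellDiff (Q i))) =
      smoothInd r (v i) s := by
    rw [← subPoly_cellDiff (hQ i), ← isLinearMap_subPoly.map_add, add_sub_cancel]
    rfl
  have hη : Tendsto (fun i => h i ^ (r - k)) l (𝓝[≠] 0) := by
    refine tendsto_nhdsWithin_iff.2 ⟨?_, ?_⟩
    · simpa [(Nat.sub_pos_of_lt hkr).ne'] using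
        (tendsto_nhds_of_tendsto_nhdsWithin hh).pow (r - k)
    · filter_upwards [hh self_mem_nhdsWithin] with i hi using pow_ne_zero _ hi
  have hsub : (fun i => polyInd r (subPoly r s (v i - cellDiff (Q i))))
      =O[l] fun i => (h i ^ r) ^ 2 :=
    polyInd_isBigO fun j =>
      iterate_derivative_reconPoly_isBigO (e := fun i => v i - cellDiff (Q i)) r _ j
        isCompact_uIcc hv
  have hpow (i : ι) : (h i ^ r) ^ 2 = (h i ^ (r - k)) ^ 2 * h i ^ (2 * k) := by
    rw [← pow_mul, ← pow_mul, ← pow_add]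
    congr 1
    omega
  refine (polyInd_add_sub_isBigO hη
    ((hsub.congr_right hpow).trans ((isBigO_refl _ _).mul hB))).congr_left fun i => ?_
  rw [hsplit]

end SmoothnessIndicators

section NonlinearWeights

variable {ι : Type*} {l : Filter ι}

lemma normalize_sub_isBigO {σ : Type*} [Fintype σ] {a : ι → σ → ℝ} {d : σ → ℝ} {g : ι → ℝ}
    (hd : ∑ s, d s = 1) (hg : Tendsto g l (𝓝 0)) (ha : ∀ s, (fun i => a i s - d s) =O[l] g)
    (s : σ) : (fun i => a i s / ∑ t, a i t - d s) =O[l] g := by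
  have hsum : (fun i => ∑ t, a i t - 1) =O[l] g :=
    (IsBigO.fun_sum fun t _ => ha t).congr_left fun i => by rw [Finset.sum_sub_distrib, hd]
  have hlim : Tendsto (fun i => ∑ t, a i t) l (𝓝 1) :=
    tendsto_sub_nhds_zero_iff.1 (hsum.trans_tendsto hg)
  have hinv : (fun i => (∑ t, a i t)⁻¹) =O[l] fun _ => (1 : ℝ) :=
    (hlim.inv₀ one_ne_zero).isBigO_one ℝ
  refine (((ha s).sub (hsum.const_mul_left (d s))).mul hinv).congr' ?_ (by simp)
  filter_upwards [hlim.eventually_ne one_ne_zero] with i hi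
  field_simp
  ring

variable {r : ℕ} {v : ι → ℤ → ℝ} {ε B τ : ι → ℝ}

lemma scaled_alphaJS_sub_optWeight_isBigO (hτ : Tendsto τ l (𝓝 0)) (hB : ∀ᶠ i in l, 0 < B i)
    (hε : ∀ᶠ i in l, 0 ≤ ε i) {s : Fin r}
    (hβ : (fun i => smoothInd r (v i) s - B i) =O[l] fun i => τ i * B i) :
    (fun i => (ε i + B i) ^ 2 * alphaJS r (ε i) (v i) s - optWeight r s) =O[l] τ := by
  set θ : ι → ℝ := fun i => (smoothInd r (v i) s - B i) / (ε i + B i) with hθ_def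
  have hθ : θ =O[l] τ := by
    have hle : (fun i => B i * (ε i + B i)⁻¹) =O[l] fun _ => (1 : ℝ) := by
      refine .of_bound 1 ?_
      filter_upwards [hB, hε] with i hBi hεi
      rw [← div_eq_mul_inv, Real.norm_of_nonneg (by positivity), norm_one, mul_one]
      exact div_le_one_of_le₀ (by linarith) (by positivity)
    refine ((hβ.mul (isBigO_refl (fun i => (ε i + B i)⁻¹) l)).trans ?_)
    simpa [mul_assoc] using (isBigO_refl τ l).mul hle
  have hdiff : DifferentiableAt ℝ (fun z : ℝ => ((1 + z) ^ 2)⁻¹) 0 := by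
    fun_prop (disch := norm_num)
  have hinv : (fun i => ((1 + θ i) ^ 2)⁻¹ - 1) =O[l] θ := by
    simpa [Function.comp_def] using hdiff.isBigO_sub.comp_tendsto (hθ.trans_tendsto hτ)
  refine ((hinv.const_mul_left (optWeight r s)).trans hθ).congr' ?_ .rfl
  filter_upwards [hB, hε] with i hBi hεi
  have hpos : ε i + B i ≠ 0 := by positivity
  have hscale : ε i + smoothInd r (v i) s = (ε i + B i) * (1 + θ i) := by
    rw [hθ_def]
    field_simp
    ring
  rw [alphaJS, hscale, mul_pow, ← mul_div_assoc, mul_div_mul_left _ _ (pow_ne_zero 2 hpos)]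
  simp [div_eq_mul_inv, mul_sub]

theorem weightJS_sub_optWeight_isBigO (hr : 0 < r) (hτ : Tendsto τ l (𝓝 0))
    (hB : ∀ᶠ i in l, 0 < B i) (hε : ∀ᶠ i in l, 0 ≤ ε i)
    (hβ : ∀ s, (fun i => smoothInd r (v i) s - B i) =O[l] fun i => τ i * B i) (s : Fin r) :
    (fun i => weightJS r (ε i) (v i) s - optWeight r s) =O[l] τ := by
  refine (normalize_sub_isBigO (sum_optWeight hr) hτ
    (fun s => scaled_alphaJS_sub_optWeight_isBigO hτ hB hε (hβ s)) s).congr' ?_ .rfl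
  filter_upwards [hB, hε] with i hBi hεi
  have hpos : ε i + B i ≠ 0 := by positivity
  rw [← Finset.mul_sum, mul_div_mul_left _ _ (pow_ne_zero 2 hpos), weightJS]

end NonlinearWeights

section MappingFunction

/-- The order to which the mapping function `gMAIM k` is in contact with the constant `d` at `d`.
For odd `k` the factor `sg` contributes one more order. -/
def contactOrder (k : ℕ) : ℕ := if Even k then k + 1 else k + 2

lemma le_contactOrder_of_add_parity_le {c : ℤ} {k : ℕ}
    (h : (c : ℝ) + (1 + (-1 : ℝ) ^ c) / 2 ≤ k) : c + 2 ≤ contactOrder k := by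
  rw [contactOrder]
  rcases Int.even_or_odd c with hc | hc
  · rw [hc.neg_one_zpow] at h
    have hck : c + 1 ≤ k := by
      have : (c : ℝ) + 1 ≤ k := by linarith
      exact_mod_cast this
    split_ifs with hk <;> grind
  · rw [hc.neg_one_zpow] at h
    have hck : c ≤ k := by
      have : (c : ℝ) ≤ k := by linarith
      exact_mod_cast this
    split_ifs with hk <;> grind

theorem le_contactOrder_mul {r n k : ℕ} (hn : n + 1 < r) (hk : kMAIM r n ≤ k) :
    r ≤ contactOrder k * (r - (n + 1)) := by
  have hcast : ((r - (n + 1) : ℕ) : ℝ) = (r : ℝ) - 1 - n := by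
    rw [Nat.cast_sub hn.le]
    push_cast
    ring
  have hpos : (0 : ℝ) < (r : ℝ) - 1 - n := by
    rw [← hcast]
    exact_mod_cast Nat.sub_pos_of_lt hn
  have hceil := Int.le_ceil ((r : ℝ) / ((r : ℝ) - 1 - n) - 2)
  have hcontact : (⌈(r : ℝ) / ((r : ℝ) - 1 - n) - 2⌉ : ℝ) + 2 ≤ contactOrder k := by
    exact_mod_cast le_contactOrder_of_add_parity_le hk
  have hratio : (r : ℝ) / ((r : ℝ) - 1 - n) ≤ contactOrder k := by linarith
  rw [div_le_iff₀ hpos, ← hcast] at hratio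
  exact_mod_cast hratio

lemma sg_mul_nonneg (k : ℕ) (δ x : ℝ) : 0 ≤ sg k δ x * x := by
  rw [sg]
  split_ifs with h
  · rw [div_mul_eq_mul_div]
    exact div_nonneg (mul_self_nonneg x) (abs_nonneg x)
  · have hsq : x ^ 2 ≤ δ ^ 2 :=
      sq_le_sq' (neg_le_of_abs_le (not_le.1 h).le) (le_of_abs_le (not_le.1 h).le)
    rw [div_mul_eq_mul_div]
    exact div_nonneg (mul_self_nonneg x)
      (add_nonneg (pow_nonneg (sub_nonneg.2 hsq) _) (abs_nonneg x))

lemma sg_isBigO (k : ℕ) {δ : ℝ} (hδ : 0 < δ) : sg k δ =O[𝓝 0] fun x => x := by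
  have hinv : (fun x : ℝ => ((δ ^ 2 - x ^ 2) ^ (k + 3) + |x|)⁻¹) =O[𝓝 0] fun _ => (1 : ℝ) := by
    refine (ContinuousAt.inv₀ (by fun_prop) ?_).isBigO_one ℝ
    simp [hδ.ne']
  have hsmall : ∀ᶠ x : ℝ in 𝓝 0, |x| < δ :=
    (continuous_abs.tendsto 0).eventually_lt_const (by simpa)
  refine ((isBigO_refl (fun x => x) _).mul hinv).congr' ?_ (by simp)
  filter_upwards [hsmall] with x hx
  rw [sg, if_neg hx.not_ge, div_eq_mul_inv]

variable {k : ℕ} {A δ d : ℝ}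

lemma fMAIM_of_even (hk : Even k) (z : ℝ) : fMAIM k A δ d z = A := by
  simp [fMAIM, hk.neg_one_pow, hk.add_one.neg_one_pow]

lemma fMAIM_of_odd (hk : Odd k) (z : ℝ) : fMAIM k A δ d z = A * sg k δ (z - d) := by
  simp [fMAIM, hk.neg_one_pow, hk.add_one.neg_one_pow]

lemma fMAIM_mul_pow_nonneg (hA : 0 ≤ A) (z : ℝ) : 0 ≤ fMAIM k A δ d z * (z - d) ^ k := by
  rcases Nat.even_or_odd k with hk | hk
  · rw [fMAIM_of_even hk]
    exact mul_nonneg hA (hk.pow_nonneg _)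
  · rw [fMAIM_of_odd hk]
    obtain ⟨j, rfl⟩ := hk
    calc 0 ≤ A * (sg (2 * j + 1) δ (z - d) * (z - d)) * ((z - d) ^ j) ^ 2 :=
          mul_nonneg (mul_nonneg hA (sg_mul_nonneg _ _ _)) (sq_nonneg _)
      _ = A * sg (2 * j + 1) δ (z - d) * (z - d) ^ (2 * j + 1) := by ring

lemma fMAIM_mul_pow_isBigO (hδ : 0 < δ) :
    (fun z => fMAIM k A δ d z * (z - d) ^ (k + 1)) =O[𝓝 d] fun z => (z - d) ^ contactOrder k := by
  rcases Nat.even_or_odd k with hk | hk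
  · simp only [fMAIM_of_even hk, contactOrder, if_pos hk]
    exact isBigO_const_mul_self _ _ _
  · have hlim : Tendsto (fun z => z - d) (𝓝 d) (𝓝 0) := tendsto_sub_nhds_zero_iff.2 tendsto_id
    simp only [fMAIM_of_odd hk, contactOrder, if_neg (Nat.not_even_iff_odd.2 hk), mul_assoc,
      pow_succ' _ (k + 1)]
    exact (((sg_isBigO k hδ).comp_tendsto hlim).mul (isBigO_refl _ _)).const_mul_left A

variable {ι : Type*} {l : Filter ι} {w e e0 e1 : ι → ℝ}

lemma exists_pos_eventually_le_rpow (hd0 : 0 < d) (hd1 : d < 1) (hw : Tendsto w l (𝓝 d))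
    (he : IsBoundedUnder (· ≤ ·) l e) : ∃ c > 0, ∀ᶠ i in l, c ≤ w i ^ e i := by
  obtain ⟨E, hE⟩ := he
  refine ⟨(d / 2) ^ max E 0, by positivity, ?_⟩
  filter_upwards [eventually_map.1 hE, hw.eventually_const_lt (half_lt_self hd0),
    hw.eventually_lt_const hd1] with i hEi hlow hup
  calc (d / 2) ^ max E 0 ≤ w i ^ max E 0 :=
        Real.rpow_le_rpow (by positivity) hlow.le (le_max_right _ _)
    _ ≤ w i ^ e i := Real.rpow_le_rpow_of_exponent_ge (by linarith) hup.le
        (hEi.trans (le_max_left _ _))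

theorem gMAIM_sub_isBigO (hA : 0 ≤ A) (hδ : 0 < δ) (hd0 : 0 < d) (hd1 : d < 1)
    (hw : Tendsto w l (𝓝 d)) (he0 : IsBoundedUnder (· ≤ ·) l e0)
    (he1 : IsBoundedUnder (· ≤ ·) l e1) :
    (fun i => gMAIM k A δ d (e0 i) (e1 i) (w i) - d)
      =O[l] fun i => (w i - d) ^ contactOrder k := by
  obtain ⟨c₀, hc₀, hle₀⟩ := exists_pos_eventually_le_rpow hd0 hd1 hw he0
  obtain ⟨c₁, hc₁, hle₁⟩ := exists_pos_eventually_le_rpow (sub_pos.2 hd1) (sub_lt_self 1 hd0)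
    (hw.const_sub 1) he1
  have hinv : (fun i => (fMAIM k A δ d (w i) * (w i - d) ^ k +
      w i ^ e0 i * (1 - w i) ^ e1 i)⁻¹) =O[l] fun _ => (1 : ℝ) := by
    refine .of_bound (c₀ * c₁)⁻¹ ?_
    filter_upwards [hle₀, hle₁] with i h0 h1
    have hden : c₀ * c₁ ≤ fMAIM k A δ d (w i) * (w i - d) ^ k + w i ^ e0 i * (1 - w i) ^ e1 i :=
      (mul_le_mul h0 h1 hc₁.le (hc₀.le.trans h0)).trans
        (le_add_of_nonneg_left (fMAIM_mul_pow_nonneg hA _))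
    have hpos : 0 < c₀ * c₁ := by positivity
    rw [norm_one, mul_one, norm_inv, Real.norm_of_nonneg (hpos.le.trans hden)]
    exact inv_anti₀ hpos hden
  refine (((fMAIM_mul_pow_isBigO (k := k) (A := A) hδ).comp_tendsto hw).mul hinv).congr
    (fun i => ?_) fun i => ?_
  · simp only [Function.comp_apply, gMAIM, add_sub_cancel_left, div_eq_mul_inv]
  · simp only [Function.comp_apply, mul_one]

end MappingFunction

section AdaptiveExponents

lemma ciSup_div_ciInf_add_le {σ : Type*} [Nonempty σ] {a : σ → ℝ} {b c εA : ℝ} (hεA : 0 ≤ εA)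
    (hb : 0 < b) (hlow : ∀ j, b ≤ a j) (hup : ∀ j, a j ≤ c * b) :
    (⨆ j, a j) / ((⨅ j, a j) + εA) ≤ c := by
  have hsup : ⨆ j, a j ≤ c * b := ciSup_le hup
  have hinf : b ≤ ⨅ j, a j := le_ciInf hlow
  have hc : 0 ≤ c := by
    obtain ⟨j⟩ := ‹Nonempty σ›
    exact nonneg_of_mul_nonneg_left (hb.le.trans ((hlow j).trans (hup j))) hb
  rw [div_le_iff₀ (by linarith)]
  exact hsup.trans (mul_le_mul_of_nonneg_left (by linarith) hc)

variable {ι : Type*} {l : Filter ι} {B : ι → ℝ} {εA : ℝ}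

lemma isBoundedUnder_ciSup_div_ciInf_add {σ : Type*} [Finite σ] [Nonempty σ] {a : ι → σ → ℝ}
    (hεA : 0 ≤ εA) (hB : ∀ᶠ i in l, 0 < B i) (ha : ∀ j, (fun i => a i j - B i) =o[l] B) :
    IsBoundedUnder (· ≤ ·) l fun i => (⨆ j, a i j) / ((⨅ j, a i j) + εA) := by
  have hclose : ∀ᶠ i in l, ∀ j, ‖a i j - B i‖ ≤ 1 / 2 * ‖B i‖ :=
    eventually_all.2 fun j => (ha j).bound (by norm_num)
  refine isBoundedUnder_of_eventually_le (a := 3) ?_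
  filter_upwards [hB, hclose] with i hBi hi
  simp only [Real.norm_of_nonneg hBi.le, Real.norm_eq_abs, abs_le] at hi
  exact ciSup_div_ciInf_add_le hεA (half_pos hBi) (fun j => by linarith [(hi j).1])
    fun j => by linarith [(hi j).2]

variable {r : ℕ} {β w : ι → Fin r → ℝ}

lemma isBoundedUnder_ada2 (k : ℕ) (Q : ℝ) (CFS : Fin r → ℝ) (s : Fin r) (f : ι → ℝ) :
    IsBoundedUnder (· ≤ ·) l fun i => ada2 k Q CFS s (f i) :=
  isBoundedUnder_of_eventually_le (a := max 1 (Q * k)) <| .of_forall fun i => by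
    rw [ada2]
    split_ifs
    exacts [le_max_left _ _, le_max_right _ _]

lemma isBoundedUnder_div_mul_add {f : ι → ℝ} {m d : ℝ} (hm : 0 < m) (hd : 0 < d) (hεA : 0 ≤ εA)
    (hf : Tendsto f l (𝓝 d)) : IsBoundedUnder (· ≤ ·) l fun i => d / (m * f i + εA) :=
  (Tendsto.div tendsto_const_nhds ((hf.const_mul m).add_const εA)
    (by positivity)).isBoundedUnder_le

theorem isBoundedUnder_exp (hr : 2 ≤ r) {T : AdaType r}
    (hT : ∀ m, T = .type1 m → ∀ s, 0 < m s) (hεA : 0 ≤ εA) (hB : ∀ᶠ i in l, 0 < B i)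
    (hβ : ∀ j, (fun i => β i j - B i) =o[l] B)
    (hw : ∀ j, Tendsto (fun i => w i j) l (𝓝 (optWeight r j))) (k : ℕ) (s : Fin r) :
    IsBoundedUnder (· ≤ ·) l (fun i => T.exp0 k εA (β i) (w i) s) ∧
      IsBoundedUnder (· ≤ ·) l (fun i => T.exp1 k εA (β i) (w i) s) := by
  have : Nonempty (Fin r) := ⟨s⟩
  cases T with
  | type1 m =>
    exact ⟨isBoundedUnder_div_mul_add (hT m rfl s) (optWeight_pos s) hεA (hw s),
      isBoundedUnder_div_mul_add (hT m rfl s) (sub_pos.2 (optWeight_lt_one hr s)) hεA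
        ((hw s).const_sub 1)⟩
  | type2 Q CFS => exact ⟨isBoundedUnder_ada2 k Q CFS s _, isBoundedUnder_ada2 k Q CFS s _⟩
  | type3 => exact ⟨isBoundedUnder_ciSup_div_ciInf_add hεA hB hβ,
      isBoundedUnder_ciSup_div_ciInf_add hεA hB hβ⟩
  | type4 =>
    have hquot (j : Fin r) : (fun i => w i j / optWeight r j - 1) =o[l] fun _ => (1 : ℝ) := by
      refine (isLittleO_one_iff ℝ).2 (tendsto_sub_nhds_zero_iff.2 ?_)
      simpa [(optWeight_pos j).ne'] using (hw j).div_const (optWeight r j)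
    have hratio := isBoundedUnder_ciSup_div_ciInf_add (B := fun _ => 1) hεA (by simp) hquot
    exact ⟨hratio, hratio⟩
  | type5 c => exact ⟨isBoundedUnder_const, isBoundedUnder_const⟩

end AdaptiveExponents

section MappedWeights

/-- The conditions on the parameters under which the mapped weights approximate the optimal ones.
They do not involve `ε`, which is allowed to vary along with the mesh width. -/
structure Params.Admissible {r : ℕ} (P : Params r) : Prop where
  A_nonneg : 0 ≤ P.A
  δ_pos : 0 < P.δ
  εA_nonneg : 0 ≤ P.εA
  type1_pos : ∀ m, P.T = .type1 m → ∀ s, 0 < m s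

variable {ι : Type*} {l : Filter ι} {r : ℕ} {P : Params r} {v : ι → ℤ → ℝ} {ε B τ : ι → ℝ}

theorem weightMAIM_sub_optWeight_isBigO (hr : 2 ≤ r) (hP : P.Admissible)
    (hτ : Tendsto τ l (𝓝 0)) (hB : ∀ᶠ i in l, 0 < B i) (hε : ∀ᶠ i in l, 0 ≤ ε i)
    (hβ : ∀ s, (fun i => smoothInd r (v i) s - B i) =O[l] fun i => τ i * B i) (s : Fin r) :
    (fun i => weightMAIM { P with ε := ε i } (v i) s - optWeight r s)
      =O[l] fun i => τ i ^ contactOrder P.k := by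
  have hr0 : 0 < r := by omega
  have hJS := weightJS_sub_optWeight_isBigO hr0 hτ hB hε hβ
  have hJS_lim (s : Fin r) : Tendsto (fun i => weightJS r (ε i) (v i) s) l (𝓝 (optWeight r s)) :=
    tendsto_sub_nhds_zero_iff.1 ((hJS s).trans_tendsto hτ)
  have hβ' (s : Fin r) : (fun i => smoothInd r (v i) s - B i) =o[l] B := by
    refine (hβ s).trans_isLittleO ?_
    simpa using ((isLittleO_one_iff ℝ).2 hτ).mul_isBigO (isBigO_refl B l)
  have halpha (s : Fin r) : (fun i => alphaMAIM { P with ε := ε i } (v i) s - optWeight r s)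
      =O[l] fun i => τ i ^ contactOrder P.k := by
    obtain ⟨he0, he1⟩ := isBoundedUnder_exp hr hP.type1_pos hP.εA_nonneg hB hβ' hJS_lim P.k s
    exact (gMAIM_sub_isBigO hP.A_nonneg hP.δ_pos (optWeight_pos s) (optWeight_lt_one hr s)
      (hJS_lim s) he0 he1).trans ((hJS s).pow _)
  have hcontact : contactOrder P.k ≠ 0 := by
    rw [contactOrder]
    split_ifs <;> omega
  exact normalize_sub_isBigO (sum_optWeight hr0)
    (by simpa [hcontact] using hτ.pow (contactOrder P.k)) halpha s

end MappedWeights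

section Expansion

/-- The averages of `u` over the cells of width `h`, labelled relative to the cell with centre
`x`. -/
noncomputable def cellAverages (u : ℝ → ℝ) (h x : ℝ) (m : ℤ) : ℝ :=
  cellAvg u h (x + m * h)

/-- The leading coefficient of the error of the optimal reconstruction: on smooth `u` this error is
`errorConst r * u^(2r-1) * h^(2r-1)` up to terms of order `2r`. -/
noncomputable def errorConst (r : ℕ) : ℝ :=
  (∑ s, optWeight r s * subValue r s (cellDiff (X ^ (2 * r))) -
    (derivative (X ^ (2 * r) : ℝ[X])).eval (1 / 2)) / (2 * r)!

lemma cellDiff_add_C_mul (Q S : ℝ[X]) (c : ℝ) :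
    cellDiff (Q + C c * S) = cellDiff Q + c • cellDiff S := by
  funext m
  simp only [cellDiff, Polynomial.eval_add, Polynomial.eval_C_mul, Pi.add_apply, Pi.smul_apply,
    smul_eq_mul]
  ring

lemma sum_optWeight_mul_subValue_taylorPrimitive {r : ℕ} (hr : 0 < r) (u : ℝ → ℝ) (h x : ℝ) :
    ∑ s, optWeight r s * subValue r s (cellDiff (taylorPrimitive u (2 * r) h x)) =
      (taylorPoly u (2 * r) h x).eval (1 / 2) +
        errorConst r * (iteratedDeriv (2 * r - 1) u x * h ^ (2 * r - 1)) := by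
  obtain ⟨N, hN⟩ : ∃ N, 2 * r = N + 1 := ⟨2 * r - 1, by omega⟩
  set c := iteratedDeriv N u x * h ^ N / (N + 1)! with hc
  have htop : taylorPrimitive u (2 * r) h x = taylorPrimitive u N h x + C c * X ^ (2 * r) := by
    rw [hN, taylorPrimitive, Finset.sum_range_succ, taylorPrimitive]
  have hexact := sum_optWeight_mul_subValue_cellDiff hr
    ((natDegree_taylorPrimitive_le u N h x).trans (show N ≤ 2 * r - 1 by omega))
  have hfact : ((N + 1)! : ℝ) ≠ 0 := by positivity
  rw [← derivative_taylorPrimitive, htop, cellDiff_add_C_mul, errorConst]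
  simp only [isLinearMap_subValue.map_add, isLinearMap_subValue.map_smul, mul_add,
    Finset.sum_add_distrib, hexact, smul_eq_mul, mul_left_comm _ c, ← Finset.mul_sum,
    Polynomial.derivative_add, Polynomial.derivative_C_mul, Polynomial.eval_add,
    Polynomial.eval_C_mul]
  rw [hN, Nat.add_sub_cancel, hc]
  field_simp
  ring

variable {ι : Type*} {l : Filter ι} {r n N : ℕ} {u : ℝ → ℝ} {x₀ : ℝ} {h x x' ε : ι → ℝ}

lemma subValue_cellAverages_sub_isBigO (hu : ContDiffAt ℝ N u x₀) (hh : Tendsto h l (𝓝[≠] 0))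
    (hx : Tendsto x l (𝓝 x₀)) (s : Fin r) :
    (fun i => subValue r s (cellAverages u (h i) (x i)) -
      subValue r s (cellDiff (taylorPrimitive u N (h i) (x i)))) =O[l] fun i => h i ^ N := by
  simp only [← isLinearMap_subValue.map_sub]
  exact subValue_isBigO (cellAvg_sub_cellDiff_isBigO hu hh hx)

lemma sub_eval_half_taylorPoly_isBigO (hu : ContDiffAt ℝ N u x₀) (hh : Tendsto h l (𝓝[≠] 0))
    (hx : Tendsto x l (𝓝 x₀)) :
    (fun i => u (x i + h i / 2) - (taylorPoly u N (h i) (x i)).eval (1 / 2))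
      =O[l] fun i => h i ^ N := by
  have huniform := sub_eval_taylorPoly_isBigO (isCompact_singleton (x := (1 / 2 : ℝ))) hu
    (tendsto_nhds_of_tendsto_nhdsWithin hh) hx
  simpa [Function.comp_def, div_eq_mul_inv] using huniform.comp_tendsto
    (tendsto_id.prodMk (tendsto_principal.2 (.of_forall fun _ => mem_singleton (1 / 2 : ℝ))))

lemma subValue_sub_isBigO (hu : ContDiffAt ℝ r u x₀) (hh : Tendsto h l (𝓝[≠] 0))
    (hx : Tendsto x l (𝓝 x₀)) (s : Fin r) :
    (fun i => subValue r s (cellAverages u (h i) (x i)) - u (x i + h i / 2))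
      =O[l] fun i => h i ^ r := by
  refine ((subValue_cellAverages_sub_isBigO hu hh hx s).sub
    (sub_eval_half_taylorPoly_isBigO hu hh hx)).congr_left fun i => ?_
  rw [subValue, subValue, subPoly_cellDiff (natDegree_taylorPrimitive_le u r _ _),
    derivative_taylorPrimitive]
  ring

theorem sum_optWeight_mul_subValue_sub_isBigO (hr : 0 < r)
    (hu : ContDiffAt ℝ (2 * r : ℕ) u x₀) (hh : Tendsto h l (𝓝[≠] 0)) (hx : Tendsto x l (𝓝 x₀)) :
    (fun i => ∑ s, optWeight r s * subValue r s (cellAverages u (h i) (x i)) -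
      u (x i + h i / 2) - errorConst r * (iteratedDeriv (2 * r - 1) u (x i) * h i ^ (2 * r - 1)))
      =O[l] fun i => h i ^ (2 * r) := by
  have hsum := IsBigO.fun_sum (s := Finset.univ) fun s _ =>
    (subValue_cellAverages_sub_isBigO hu hh hx s).const_mul_left (optWeight r s)
  refine (hsum.sub (sub_eval_half_taylorPoly_isBigO hu hh hx)).congr_left fun i => ?_
  simp only [mul_sub, Finset.sum_sub_distrib, sum_optWeight_mul_subValue_taylorPrimitive hr]
  ring

variable {P : Params r}

theorem weightMAIM_cellAverages_sub_isBigO (hn : n + 1 < r) (hk : kMAIM r n ≤ P.k)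
    (hP : P.Admissible) (hu : ContDiffAt ℝ r u x₀) (hcp : iteratedDeriv (n + 1) u x₀ ≠ 0)
    (hh : Tendsto h l (𝓝[≠] 0)) (hx : Tendsto x l (𝓝 x₀)) (hε : ∀ᶠ i in l, 0 ≤ ε i) (s : Fin r) :
    (fun i => weightMAIM { P with ε := ε i } (cellAverages u (h i) (x i)) s - optWeight r s)
      =O[l] fun i => h i ^ r := by
  have hh0 := tendsto_nhds_of_tendsto_nhdsWithin hh
  have hlower := pow_isBigO_polyInd_taylorPoly n.succ_pos hn hu hcp hh0 hx
  have hpos : ∀ᶠ i in l, 0 < polyInd r (taylorPoly u r (h i) (x i)) := by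
    filter_upwards [hlower.eq_zero_imp, hh self_mem_nhdsWithin] with i hi hhi
    exact (polyInd_nonneg r _).lt_of_ne' fun h0 => pow_ne_zero _ hhi (hi h0)
  have hτ : Tendsto (fun i => h i ^ (r - (n + 1))) l (𝓝 0) := by
    simpa [(Nat.sub_pos_of_lt hn).ne'] using hh0.pow (r - (n + 1))
  have hβ (s : Fin r) := smoothInd_sub_polyInd_isBigO hn hh
    (fun i => natDegree_taylorPrimitive_le u r (h i) (x i)) (cellAvg_sub_cellDiff_isBigO hu hh hx)
    (by simpa only [derivative_taylorPrimitive] using hlower) s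
  simp only [derivative_taylorPrimitive] at hβ
  refine (weightMAIM_sub_optWeight_isBigO (by omega) hP hτ hpos hε hβ s).trans ?_
  simp only [← pow_mul, mul_comm _ (contactOrder P.k)]
  exact isBigO_pow_of_le hh0 (le_contactOrder_mul hn hk)

lemma eventually_sum_weightMAIM_eq_one (hr : 0 < r) {P : ι → Params r} {v : ι → ℤ → ℝ}
    (hw : ∀ s, Tendsto (fun i => weightMAIM (P i) (v i) s) l (𝓝 (optWeight r s))) :
    ∀ᶠ i in l, ∑ s, weightMAIM (P i) (v i) s = 1 := by
  have hlim : Tendsto (fun i => ∑ s, weightMAIM (P i) (v i) s) l (𝓝 1) :=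
    sum_optWeight hr ▸ tendsto_finsetSum _ fun s _ => hw s
  filter_upwards [hlim.eventually_ne one_ne_zero] with i hi
  simp only [weightMAIM, ← Finset.sum_div] at hi ⊢
  exact div_self (div_ne_zero_iff.1 hi).1

lemma recon_sub_eq (hr : 0 < r) {v : ℤ → ℝ} (hw : ∑ s, weightMAIM P v s = 1) (y : ℝ) :
    recon P v - y = ∑ s, (weightMAIM P v s - optWeight r s) * (subValue r s v - y) +
      (∑ s, optWeight r s * subValue r s v - y) := by
  simp only [recon, sub_mul, mul_sub, Finset.sum_sub_distrib, ← Finset.sum_mul, hw,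
    sum_optWeight hr]
  ring

theorem uMinus_expansion (hn : n + 1 < r) (hk : kMAIM r n ≤ P.k) (hP : P.Admissible)
    (hu : ContDiffAt ℝ (2 * r : ℕ) u x₀) (hcp : iteratedDeriv (n + 1) u x₀ ≠ 0)
    (hh : Tendsto h l (𝓝[≠] 0)) (hx : Tendsto x l (𝓝 x₀)) (hε : ∀ᶠ i in l, 0 ≤ ε i) :
    (fun i => uMinus { P with ε := ε i } u (h i) (x i) - u (x i + h i / 2) -
      errorConst r * (iteratedDeriv (2 * r - 1) u (x i) * h i ^ (2 * r - 1)))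
      =O[l] fun i => h i ^ (2 * r) := by
  have hr : 0 < r := by omega
  have hur : ContDiffAt ℝ r u x₀ := hu.of_le (by exact_mod_cast (by omega : r ≤ 2 * r))
  have hw := weightMAIM_cellAverages_sub_isBigO hn hk hP hur hcp hh hx hε
  have hhr : Tendsto (fun i => h i ^ r) l (𝓝 0) := by
    simpa [hr.ne'] using (tendsto_nhds_of_tendsto_nhdsWithin hh).pow r
  have hnonlinear := IsBigO.fun_sum (s := Finset.univ) fun s _ =>
    (hw s).mul (subValue_sub_isBigO hur hh hx s)
  simp only [← pow_add, ← two_mul] at hnonlinear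
  refine (hnonlinear.add (sum_optWeight_mul_subValue_sub_isBigO hr hu hh hx)).congr' ?_ .rfl
  filter_upwards [eventually_sum_weightMAIM_eq_one hr fun s =>
    tendsto_sub_nhds_zero_iff.1 ((hw s).trans_tendsto hhr)] with i hi
  have herror := recon_sub_eq hr hi (u (x i + h i / 2))
  change _ = recon _ (cellAverages u (h i) (x i)) - _ - _
  rw [herror]
  ring

theorem uMinus_sub_isBigO (hn : n + 1 < r) (hk : kMAIM r n ≤ P.k) (hP : P.Admissible)
    (hu : ContDiffAt ℝ (2 * r : ℕ) u x₀) (hcp : iteratedDeriv (n + 1) u x₀ ≠ 0)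
    (hh : Tendsto h l (𝓝[≠] 0)) (hx : Tendsto x l (𝓝 x₀)) (hε : ∀ᶠ i in l, 0 ≤ ε i) :
    (fun i => uMinus { P with ε := ε i } u (h i) (x i) - u (x i + h i / 2))
      =O[l] fun i => h i ^ (2 * r - 1) := by
  have hdiff : ContDiffAt ℝ 1 (iteratedDeriv (2 * r - 1) u) x₀ :=
    contDiffAt_iteratedDeriv hu (by norm_cast; omega)
  have hlead : (fun i => iteratedDeriv (2 * r - 1) u (x i) * h i ^ (2 * r - 1))
      =O[l] fun i => h i ^ (2 * r - 1) := by
    simpa using ((hdiff.continuousAt.tendsto.comp hx).isBigO_one ℝ).mul (isBigO_refl _ l)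
  have hpow : (fun i => h i ^ (2 * r)) =O[l] fun i => h i ^ (2 * r - 1) :=
    isBigO_pow_of_le (tendsto_nhds_of_tendsto_nhdsWithin hh) (Nat.sub_le _ _)
  exact (((uMinus_expansion hn hk hP hu hcp hh hx hε).trans hpow).add
    (hlead.const_mul_left (errorConst r))).congr_left fun i => by ring

theorem uMinus_sub_sub_isBigO (hn : n + 1 < r) (hk : kMAIM r n ≤ P.k) (hP : P.Admissible)
    (hu : ContDiffAt ℝ (2 * r : ℕ) u x₀) (hcp : iteratedDeriv (n + 1) u x₀ ≠ 0)
    (hh : Tendsto h l (𝓝[≠] 0)) (hx : Tendsto x l (𝓝 x₀)) (hε : ∀ᶠ i in l, 0 ≤ ε i)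
    (hx' : Tendsto x' l (𝓝 x₀)) (hxx' : (fun i => x i - x' i) =O[l] h) :
    (fun i => uMinus { P with ε := ε i } u (h i) (x i) - u (x i + h i / 2) -
      (uMinus { P with ε := ε i } u (h i) (x' i) - u (x' i + h i / 2)))
      =O[l] fun i => h i ^ (2 * r) := by
  have hdiff : ContDiffAt ℝ 1 (iteratedDeriv (2 * r - 1) u) x₀ :=
    contDiffAt_iteratedDeriv hu (by norm_cast; omega)
  have hD : (fun i => iteratedDeriv (2 * r - 1) u (x i) - iteratedDeriv (2 * r - 1) u (x' i))
      =O[l] h :=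
    ((hdiff.hasStrictDerivAt one_ne_zero).hasStrictFDerivAt.isBigO_sub.comp_tendsto
      (hx.prodMk_nhds hx')).trans hxx'
  have hlead := (hD.mul (isBigO_refl (fun i => h i ^ (2 * r - 1)) l)).const_mul_left (errorConst r)
  simp only [← pow_succ', show 2 * r - 1 + 1 = 2 * r by omega] at hlead
  exact (((uMinus_expansion hn hk hP hu hcp hh hx hε).sub
    (uMinus_expansion hn hk hP hu hcp hh hx' hε)).add hlead).congr_left fun i => by ring

lemma uPlus_eq_uMinus_neg (P : Params r) (u : ℝ → ℝ) (h x : ℝ) :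
    uPlus P u h x = uMinus P u (-h) (x + h) := by
  have havg (y : ℝ) : cellAvg u (-h) y = cellAvg u h y := by
    rw [cellAvg, cellAvg, intervalIntegral.integral_symm]
    ring_nf
  simp only [uPlus, uMinus, havg]
  congr 1
  funext m
  ring_nf

theorem uPlus_sub_isBigO (hn : n + 1 < r) (hk : kMAIM r n ≤ P.k) (hP : P.Admissible)
    (hu : ContDiffAt ℝ (2 * r : ℕ) u x₀) (hcp : iteratedDeriv (n + 1) u x₀ ≠ 0)
    (hh : Tendsto h l (𝓝[≠] 0)) (hx : Tendsto x l (𝓝 x₀)) (hε : ∀ᶠ i in l, 0 ≤ ε i) :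
    (fun i => uPlus { P with ε := ε i } u (h i) (x i) - u (x i + h i / 2))
      =O[l] fun i => h i ^ (2 * r - 1) := by
  have hadd : Tendsto (fun i => x i + h i) l (𝓝 x₀) := by
    simpa using hx.add (tendsto_nhds_of_tendsto_nhdsWithin hh)
  refine .trans ?_ ((isBigO_refl h l).neg_left.pow (2 * r - 1))
  refine (uMinus_sub_isBigO hn hk hP hu hcp (tendsto_neg_nhdsNE_zero hh) hadd
    hε).congr_left fun i => ?_
  rw [uPlus_eq_uMinus_neg, add_assoc, neg_div, ← sub_eq_add_neg, sub_half]

theorem uPlus_sub_sub_isBigO (hn : n + 1 < r) (hk : kMAIM r n ≤ P.k) (hP : P.Admissible)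
    (hu : ContDiffAt ℝ (2 * r : ℕ) u x₀) (hcp : iteratedDeriv (n + 1) u x₀ ≠ 0)
    (hh : Tendsto h l (𝓝[≠] 0)) (hx : Tendsto x l (𝓝 x₀)) (hε : ∀ᶠ i in l, 0 ≤ ε i)
    (hx' : Tendsto x' l (𝓝 x₀)) (hxx' : (fun i => x i - x' i) =O[l] h) :
    (fun i => uPlus { P with ε := ε i } u (h i) (x i) - u (x i + h i / 2) -
      (uPlus { P with ε := ε i } u (h i) (x' i) - u (x' i + h i / 2)))
      =O[l] fun i => h i ^ (2 * r) := by
  have hh0 := tendsto_nhds_of_tendsto_nhdsWithin hh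
  have hadd : Tendsto (fun i => x i + h i) l (𝓝 x₀) := by simpa using hx.add hh0
  have hadd' : Tendsto (fun i => x' i + h i) l (𝓝 x₀) := by simpa using hx'.add hh0
  have hdiff : (fun i => x i + h i - (x' i + h i)) =O[l] fun i => -h i := by
    simpa using hxx'.neg_right
  refine .trans ?_ ((isBigO_refl h l).neg_left.pow (2 * r))
  refine (uMinus_sub_sub_isBigO hn hk hP hu hcp (tendsto_neg_nhdsNE_zero hh) hadd hε
    hadd' hdiff).congr_left fun i => ?_
  rw [uPlus_eq_uMinus_neg, uPlus_eq_uMinus_neg, add_assoc, add_assoc, neg_div, ← sub_eq_add_neg,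
    sub_half]

end Expansion

section Flux

variable {ι : Type*} {l : Filter ι} {r n : ℕ} {P : Params r} {u f : ℝ → ℝ} {x₀ y₀ : ℝ}

lemma fluxLF_sub_isBigO (hf : ContDiffAt ℝ 2 f y₀) (α : ℝ) {a b p q p' q' h H : ι → ℝ}
    (ha : Tendsto a l (𝓝 y₀)) (hb : Tendsto b l (𝓝 y₀)) (hH : Tendsto H l (𝓝 0))
    (hab : (fun i => a i - b i) =O[l] h)
    (hp : (fun i => p i - a i) =O[l] H) (hp' : (fun i => p' i - b i) =O[l] H)
    (hpp' : (fun i => p i - a i - (p' i - b i)) =O[l] fun i => H i * h i)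
    (hq : (fun i => q i - a i) =O[l] H) (hq' : (fun i => q' i - b i) =O[l] H)
    (hqq' : (fun i => q i - a i - (q' i - b i)) =O[l] fun i => H i * h i) :
    (fun i => fluxLF f α (p i) (q i) - f (a i) - (fluxLF f α (p' i) (q' i) - f (b i)))
      =O[l] fun i => H i * h i := by
  have hfp := isBigO_perturbation_sub hf ha hb hH hab hp hp' hpp'
  have hfq := isBigO_perturbation_sub hf ha hb hH hab hq hq' hqq'
  simp only [add_sub_cancel] at hfp hfq
  refine (((hfp.add hfq).sub ((hqq'.sub hpp').const_mul_left α)).const_mul_left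
    (1 / 2)).congr_left fun i => ?_
  simp only [fluxLF]
  ring

variable {h x x' ε : ι → ℝ}

theorem numFlux_sub_sub_isBigO (hn : n + 1 < r) (hk : kMAIM r n ≤ P.k) (hP : P.Admissible)
    (hu : ContDiffAt ℝ (2 * r : ℕ) u x₀) (hcp : iteratedDeriv (n + 1) u x₀ ≠ 0)
    (hf : ContDiffAt ℝ 2 f (u x₀)) (α : ℝ)
    (hh : Tendsto h l (𝓝[≠] 0)) (hx : Tendsto x l (𝓝 x₀)) (hε : ∀ᶠ i in l, 0 ≤ ε i)
    (hx' : Tendsto x' l (𝓝 x₀)) (hxx' : (fun i => x i - x' i) =O[l] h) :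
    (fun i => numFlux { P with ε := ε i } f α u (h i) (x i) - f (u (x i + h i / 2)) -
      (numFlux { P with ε := ε i } f α u (h i) (x' i) - f (u (x' i + h i / 2))))
      =O[l] fun i => h i ^ (2 * r - 1) * h i := by
  have hh0 := tendsto_nhds_of_tendsto_nhdsWithin hh
  have hright : Tendsto (fun i => x i + h i / 2) l (𝓝 x₀) := by
    simpa using hx.add (hh0.div_const 2)
  have hleft : Tendsto (fun i => x' i + h i / 2) l (𝓝 x₀) := by
    simpa using hx'.add (hh0.div_const 2)
  have hstrict := (hu.hasStrictDerivAt (by norm_cast; omega)).hasStrictFDerivAt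
  have hab : (fun i => u (x i + h i / 2) - u (x' i + h i / 2)) =O[l] h :=
    (hstrict.isBigO_sub.comp_tendsto (hright.prodMk_nhds hleft)).trans
      (by simpa [Function.comp_def] using hxx')
  have hH : Tendsto (fun i => h i ^ (2 * r - 1)) l (𝓝 0) := by
    simpa [show 2 * r - 1 ≠ 0 by omega] using hh0.pow (2 * r - 1)
  have hpow (i : ι) : h i ^ (2 * r) = h i ^ (2 * r - 1) * h i := by
    rw [← pow_succ, show 2 * r - 1 + 1 = 2 * r by omega]
  exact fluxLF_sub_isBigO hf α (hu.continuousAt.tendsto.comp hright)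
    (hu.continuousAt.tendsto.comp hleft) hH hab
    (uMinus_sub_isBigO hn hk hP hu hcp hh hx hε) (uMinus_sub_isBigO hn hk hP hu hcp hh hx' hε)
    ((uMinus_sub_sub_isBigO hn hk hP hu hcp hh hx hε hx' hxx').congr_right hpow)
    (uPlus_sub_isBigO hn hk hP hu hcp hh hx hε) (uPlus_sub_isBigO hn hk hP hu hcp hh hx' hε)
    ((uPlus_sub_sub_isBigO hn hk hP hu hcp hh hx hε hx' hxx').congr_right hpow)

theorem spatialOp_sub_exactOp_isBigO (hn : n + 1 < r) (hk : kMAIM r n ≤ P.k) (hP : P.Admissible)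
    (hu : ContDiffAt ℝ (2 * r : ℕ) u x₀) (hcp : iteratedDeriv (n + 1) u x₀ ≠ 0)
    (hf : ContDiffAt ℝ 2 f (u x₀)) (α : ℝ)
    (hh : Tendsto h l (𝓝[≠] 0)) (hx : Tendsto x l (𝓝 x₀)) (hε : ∀ᶠ i in l, 0 ≤ ε i) :
    (fun i => spatialOp { P with ε := ε i } f α u (h i) (x i) - exactOp f u (h i) (x i))
      =O[l] fun i => h i ^ (2 * r - 1) := by
  have hx' : Tendsto (fun i => x i - h i) l (𝓝 x₀) := by
    simpa using hx.sub (tendsto_nhds_of_tendsto_nhdsWithin hh)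
  have hflux := numFlux_sub_sub_isBigO hn hk hP hu hcp hf α hh hx hε hx'
    (by simpa using isBigO_refl h l)
  refine (hflux.mul (isBigO_refl (fun i => -(1 / h i)) l).neg_right).congr'
    (.of_forall fun i => ?_) ?_
  · simp only [spatialOp, exactOp, show x i - h i + h i / 2 = x i - h i / 2 by ring]
    ring
  · filter_upwards [hh self_mem_nhdsWithin] with i hi
    rw [neg_neg, mul_assoc, mul_one_div_cancel hi, mul_one]

end Flux

section Uniformity

lemma exists_uniform_bound_of_isBigO {β E : Type*} [SeminormedAddCommGroup E] {S : Set β} {x₀ : ℝ}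
    {F : β → ℝ → ℝ → E} {p : ℕ}
    (hF : (fun q : β × ℝ × ℝ => F q.1 q.2.1 q.2.2) =O[𝓟 S ×ˢ 𝓝[>] 0 ×ˢ 𝓝 x₀]
      fun q => q.2.1 ^ p) :
    ∃ K > 0, ∃ ρ > 0, ∃ h₀ > 0, ∀ b ∈ S, ∀ h, 0 < h → h < h₀ → ∀ x, |x - x₀| ≤ ρ →
      ‖F b h x‖ ≤ K * h ^ p := by
  obtain ⟨K, hK, hbound⟩ := hF.exists_pos
  have hbasis := (hasBasis_principal S).prod
    ((nhdsGT_basis (0 : ℝ)).prod (Metric.nhds_basis_closedBall (x := x₀)))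
  obtain ⟨⟨_, h₀, ρ⟩, ⟨_, hh₀, hρ⟩, hsub⟩ := hbasis.eventually_iff.1 hbound.bound
  refine ⟨K, hK, ρ, hρ, h₀, hh₀, fun b hb h hh hlt x hx => ?_⟩
  simpa [abs_of_pos hh] using hsub (x := (b, h, x)) ⟨hb, ⟨hh, hlt⟩, hx⟩

end Uniformity

end WENO

open Filter Topology in
theorem mainTheorem2_general {r n : ℕ} (hn : n + 1 < r) {P : WENO.Params r}
    (hk : WENO.kMAIM r n ≤ P.k) (hP : P.Admissible) {u : ℝ → ℝ} {x₀ : ℝ}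
    (hu : ContDiffAt ℝ (2 * r : ℕ) u x₀) (hcp : iteratedDeriv (n + 1) u x₀ ≠ 0) {f : ℝ → ℝ}
    (hf : ContDiffAt ℝ 2 f (u x₀)) (α : ℝ) :
    ∃ K > 0, ∃ ρ > 0, ∃ h₀ > 0, ∀ ε ≥ 0, ∀ h, 0 < h → h < h₀ → ∀ x, |x - x₀| ≤ ρ →
      |WENO.uMinus { P with ε := ε } u h x - u (x + h / 2)| ≤ K * h ^ (2 * r - 1) ∧
      |WENO.uPlus { P with ε := ε } u h x - u (x + h / 2)| ≤ K * h ^ (2 * r - 1) ∧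
      |WENO.spatialOp { P with ε := ε } f α u h x - WENO.exactOp f u h x|
        ≤ K * h ^ (2 * r - 1) := by
  set l : Filter (ℝ × ℝ × ℝ) := 𝓟 (Set.Ici 0) ×ˢ 𝓝[>] 0 ×ˢ 𝓝 x₀
  have hε : ∀ᶠ q in l, 0 ≤ q.1 := tendsto_fst.eventually (eventually_mem_principal _)
  have hh : Tendsto (fun q => q.2.1) l (𝓝[≠] 0) :=
    (tendsto_fst.comp tendsto_snd).mono_right (nhdsGT_le_nhdsNE 0)
  have hx : Tendsto (fun q => q.2.2) l (𝓝 x₀) := tendsto_snd.comp tendsto_snd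
  have herror := (WENO.uMinus_sub_isBigO hn hk hP hu hcp hh hx hε).prod_left
    ((WENO.uPlus_sub_isBigO hn hk hP hu hcp hh hx hε).prod_left
      (WENO.spatialOp_sub_exactOp_isBigO hn hk hP hu hcp hf α hh hx hε))
  simpa only [norm_prod_le_iff, Real.norm_eq_abs, Set.mem_Ici] using
    WENO.exists_uniform_bound_of_isBigO (F := fun ε h x =>
      (WENO.uMinus { P with ε := ε } u h x - u (x + h / 2),
        WENO.uPlus { P with ε := ε } u h x - u (x + h / 2),
        WENO.spatialOp { P with ε := ε } f α u h x - WENO.exactOp f u h x)) herror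

/-- The constants are uniform in `ε ≥ 0` and in the position of the grid near `x₀`. -/
theorem mainTheorem2 (r n k : ℕ) (hn : n + 1 < r) (hk1 : 1 ≤ k) (hk : WENO.kMAIM r n ≤ (k : ℝ))
    (A δ εA : ℝ) (hA : 0 < A) (hδ : 0 < δ) (hεA : 0 ≤ εA)
    (T : WENO.AdaType r) (hT : T.Admissible k)
    (u : ℝ → ℝ) (x₀ : ℝ) (hu : ContDiffAt ℝ ∞ u x₀) (hcp : WENO.IsCritOrder u x₀ n)
    (f : ℝ → ℝ) (hf : ContDiff ℝ 2 f) (α : ℝ) :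
    ∃ K > 0, ∃ ρ > 0, ∃ h₀ > 0, ∀ ε ≥ 0, ∀ h, 0 < h → h < h₀ → ∀ x, |x - x₀| ≤ ρ →
      |WENO.uMinus (r := r) ⟨k, A, δ, ε, εA, T⟩ u h x - u (x + h / 2)| ≤ K * h ^ (2 * r - 1) ∧
      |WENO.uPlus (r := r) ⟨k, A, δ, ε, εA, T⟩ u h x - u (x + h / 2)| ≤ K * h ^ (2 * r - 1) ∧
      |WENO.spatialOp (r := r) ⟨k, A, δ, ε, εA, T⟩ f α u h x - WENO.exactOp f u h x|
        ≤ K * h ^ (2 * r - 1) :=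
  mainTheorem2_general (P := ⟨k, A, δ, 0, εA, T⟩) hn hk
    ⟨hA.le, hδ, hεA, fun _ hm => by subst hm; exact hT⟩
    (contDiffAt_infty.1 hu _) hcp.2 hf.contDiffAt α
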